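/- Theorem. Let $G=(V,E)$ be a finite connected regular undirected graph with $|G|:=|V|\ge 2$ vertices (loops and multiple edges are allowed), and let $P$ be the transition matrix of the random walk on $G$, that is, its normalized adjacency matrix. Let $$H(G)=\max_{x,y\in V}\mathbb E_x T_y,\qquad T_y=\min\{t\ge 0: X_t=y\},$$ be the maximal expected hitting time of the walk $(X_t)$, and let $$T_{\mathrm{rel}}(G)=\max_{\lambda}\frac1{1-|\lambda|}\in[1,\infty],$$ where $\lambda$ runs over the eigenvalues of $P$ other than $1$ (so $T_{\mathrm{rel}}(G)=\infty$ if $-1$ is an eigenvalue). The lamplighter walk on $G^\lozenge$ has the state space $\{0,1\}^V\times V$, whose elements $(f,x)$ are a configuration $f$ of lamps and a position $x$ of the lamplighter. In each step the lamp at the current position is replaced by a fair random bit, the lamplighter makes one step of the random walk on $G$, and the lamp at the new position is replaced by an independent fair random bit. Let $Q$ be its transition matrix, $\pi$ the uniform distribution on the state space, and let $$\tau_2(G^\lozenge)=\min\Bigl\{m\ge 0:\ \Bigl(\sum_{b}\bigl(Q^t(a,b)/\pi(b)-1\bigr)^2\pi(b)\Bigr)^{1/2}\le\tfrac14\ \text{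 for all } t\ge m \text{ and all states } a\Bigr\}$$ be its $L^2$ mixing time ($\infty$ if there is no such $m$). For every $\kappa>0$ there is a constant $c=c(\kappa)>0$, depending only on $\kappa$, such that for every such $G$ with $H(G)\le\kappa\,|G|$, $$\tau_2(G^\lozenge)\ \le\ c\,|G|\,\bigl(T_{\mathrm{rel}}(G)+\log|G|\bigr).$$ -/

import Mathlib

open scoped ENNReal

noncomputable section

/-- A finite undirected graph on the vertex set `V`, given by its adjacency matrix: `adj x y` is the
number of edges between `x` and `y`. Loops and multiple edges are allowed (so that, for instance,
lazy walks are walks on graphs); a simple graph is the case of a `0`-`1` matrix with zero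
diagonal. -/
structure UGraph (V : Type*) where
  adj : V → V → ℕ
  symm : ∀ x y, adj x y = adj y x

namespace UGraph

variable {V : Type*} (G : UGraph V)

/-- Any two vertices are joined by a path. -/
def Connected : Prop :=
  ∀ x y, Relation.ReflTransGen (fun a b => G.adj a b ≠ 0) x y

variable [Fintype V]

def degree (x : V) : ℕ := ∑ y, G.adj x y

def IsRegular (d : ℕ) : Prop := ∀ x, G.degree x = d

/-- The transition matrix of the random walk on `G`; for a regular graph it is the normalized
adjacency matrix. -/
def walkMatrix : Matrix V V ℝ := Matrix.of fun x y => (G.adj x y : ℝ) / G.degree x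

end UGraph

section Chains

variable {Ω : Type*} [Fintype Ω] [DecidableEq Ω]

/-- The probability that the chain `X₀ = x, X₁, X₂, …` with transition matrix `P` does not visit `y`
at any of the times `0, …, t`: the sum of the probabilities of all such trajectories
`ω 0, …, ω t`. -/
def avoidProb (P : Matrix Ω Ω ℝ) (x y : Ω) (t : ℕ) : ℝ :=
  ∑ ω : Fin (t + 1) → Ω with ω 0 = x ∧ ∀ i, ω i ≠ y,
    ∏ i : Fin t, P (ω i.castSucc) (ω i.succ)

/-- The expected hitting time `𝔼ₓ T_y = ∑ₜ ℙₓ(T_y > t)`, where `T_y = min {t ≥ 0 | Xₜ = y}`; it may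
be infinite. -/
def expectedHittingTime (P : Matrix Ω Ω ℝ) (x y : Ω) : ℝ≥0∞ :=
  ∑' t : ℕ, ENNReal.ofReal (avoidProb P x y t)

/-- The maximal expected hitting time. -/
def maxHittingTime (P : Matrix Ω Ω ℝ) : ℝ≥0∞ :=
  ⨆ (x : Ω) (y : Ω), expectedHittingTime P x y

/-- The relaxation time: the maximum of `1 / (1 - |μ|)` over the eigenvalues `μ ≠ 1` of `P`; it is
infinite if `-1` is an eigenvalue. -/
def relaxationTime (P : Matrix Ω Ω ℝ) : ℝ≥0∞ :=
  ⨆ (μ : ℝ) (_ : Module.End.HasEigenvalue (Matrix.toLin' P) μ ∧ μ ≠ 1),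
    (ENNReal.ofReal (1 - |μ|))⁻¹

/-- The distance `‖Pᵗ(x,·)/π - 1‖` in `L²(π)`, for `π` the uniform distribution. -/
def l2Dist (P : Matrix Ω Ω ℝ) (x : Ω) (t : ℕ) : ℝ :=
  Real.sqrt (∑ y, ((P ^ t) x y / (Fintype.card Ω : ℝ)⁻¹ - 1) ^ 2 * (Fintype.card Ω : ℝ)⁻¹)

/-- The `L²` mixing time: the least time from which on the chain, whatever its initial state, is
within `1/4` of the uniform distribution in `L²`; it is infinite if there is no such time. -/
def l2MixingTime (P : Matrix Ω Ω ℝ) : ℕ∞ :=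
  ⨅ (m : ℕ) (_ : ∀ t ≥ m, ∀ x, l2Dist P x t ≤ 1 / 4), (m : ℕ∞)

end Chains

section Lamplighter

variable {V : Type*} [Fintype V] [DecidableEq V]

/-- Vertices of the lamplighter graph: a labeling of the vertices by lamp states, together with the
position of the lamplighter. -/
abbrev LampState (V : Type*) : Type _ := (V → Bool) × V

/-- The lamp at the position of the lamplighter is replaced by a fair random bit. -/
def lampRandomize : Matrix (LampState V) (LampState V) ℝ :=
  Matrix.of fun a b => if a.2 = b.2 ∧ ∀ z, z ≠ a.2 → a.1 z = b.1 z then 1 / 2 else 0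

/-- The lamplighter makes one step of the chain `P`; the lamps stay as they are. -/
def lampMove (P : Matrix V V ℝ) : Matrix (LampState V) (LampState V) ℝ :=
  Matrix.of fun a b => if a.1 = b.1 then P a.2 b.2 else 0

/-- The transition matrix of the lamplighter random walk: in each step the lamp at the current
position is randomized, the lamplighter makes a step of the random walk on `G`, and the lamp at the
new position is randomized. Thus every lamp is randomized whenever its vertex is visited. For a
simple graph `G` this is the simple random walk on the graph in which `(f, x)` and `(g, y)` are
adjacent iff `x` and `y` are adjacent and `f = g` off `{x, y}`. -/
def UGraph.lamplighterMatrix (G : UGraph V) : Matrix (LampState V) (LampState V) ℝ :=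
  lampRandomize * lampMove G.walkMatrix * lampRandomize

end Lamplighter

end

/-! Write `n` for the number of vertices and `P_S` for `P` with the rows and columns of `S` set to
zero. The characters of the lamp group split the lamplighter walk into blocks: randomizing a lamp in
`S` annihilates the character of `S` and any other lamp leaves it alone, so the walk acts on that
block as `P_S`. Hence the squared `L²` distance at time `t` is `n * ∑ S, (P_S ^ (2t)) x x - 1`
(`l2Dist_lamplighterMatrix`). The term `S = ∅` is governed by the spectral gap. The rest must beat
the number of sets `S`.

Let `R = min T_rel (κ n)` and let `G` be the Green kernel of the walk killed at rate `1/R`. The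
hitting time bound gives `G y y ≤ 3κ`. Inside each nonempty `S`, take a largest `T` with at most
about `n/R` points and `G`-energy at most `(3κ+2) #T` (`exists_low_energy_subset`). Two facts make
`T` a good substitute for `S`.

Low energy means that `T` has capacity of order `#T`, so functions vanishing on `T` have Dirichlet
eigenvalue at least of order `#T / n` (`dotProduct_self_le_of_energy`); as `T ⊆ S`, `(P_S ^ (2t)) x
x ≤ q ^ #T` with `q = exp(-2t/((7κ+5)n))`.

Maximality means that every other point of `S` feels a potential above `1` from `T`, unless `T`
already has the maximal size. The columns of `G` sum to `R`, so `S` lies in a hull of `T` with at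
most `(1+R) #T` points, and few sets `S` share a given `T`. Summing over `T` gives at most `(1 +
exp(1+R) q) ^ n - 1` (`sum_killedMatrix_pow_le`), which is small once `t` is a large multiple of `n
(R + log n)`. -/

/-! ### Quadratic forms and Dirichlet forms of symmetric stochastic matrices. -/

section SymmStochastic

open Matrix Finset

variable {V : Type*} [Fintype V] [DecidableEq V]

/-- Symmetric stochastic matrices. -/
structure IsSymmStochastic (P : Matrix V V ℝ) : Prop where
  nonneg : ∀ x y, 0 ≤ P x y
  symm : ∀ x y, P x y = P y x
  row_sum : ∀ x, ∑ y, P x y = 1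

theorem sq_dotProduct_mulVec_le {A : Matrix V V ℝ} (hs : ∀ x y, A x y = A y x)
    (hA : ∀ f, 0 ≤ f ⬝ᵥ A *ᵥ f) (f g : V → ℝ) :
    (f ⬝ᵥ A *ᵥ g) ^ 2 ≤ (f ⬝ᵥ A *ᵥ f) * (g ⬝ᵥ A *ᵥ g) := by
  have key := LinearMap.BilinForm.apply_sq_le_of_symm (Matrix.toBilin' A)
    (fun x => by rw [Matrix.toBilin'_apply']; exact hA x)
    ⟨fun x y => by
      simp only [Matrix.toBilin'_apply', RingHom.id_apply]
      rw [Matrix.dotProduct_mulVec, ← Matrix.mulVec_transpose, dotProduct_comm]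
      congr 2
      ext i j
      exact hs j i⟩ f g
  simpa only [Matrix.toBilin'_apply'] using key

omit [DecidableEq V] in
/-- A symmetric matrix whose quadratic form is bounded by `r` does not expand norms by more than
the factor `r`. -/
theorem dotProduct_mulVec_self_le {A : Matrix V V ℝ} (hs : ∀ x y, A x y = A y x) {r : ℝ}
    (hr : 0 < r) (hA : ∀ f, |f ⬝ᵥ A *ᵥ f| ≤ r * (f ⬝ᵥ f)) (f : V → ℝ) :
    (A *ᵥ f) ⬝ᵥ (A *ᵥ f) ≤ r ^ 2 * (f ⬝ᵥ f) := by
  have hsymm : ∀ u v : V → ℝ, u ⬝ᵥ A *ᵥ v = v ⬝ᵥ A *ᵥ u := by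
    intro u v
    rw [Matrix.dotProduct_mulVec, ← Matrix.mulVec_transpose, dotProduct_comm]
    congr 2
    ext i j
    exact hs j i
  have hpol : ∀ u v : V → ℝ, 2 * (u ⬝ᵥ A *ᵥ v) ≤ r * (u ⬝ᵥ u + v ⬝ᵥ v) := by
    intro u v
    have h1 := (abs_le.1 (hA (u + v))).2
    have h2 := (abs_le.1 (hA (u - v))).1
    simp only [Matrix.mulVec_add, Matrix.mulVec_sub, add_dotProduct, dotProduct_add,
      sub_dotProduct, dotProduct_sub] at h1 h2
    have h3 := hsymm u v
    have h4 := dotProduct_comm u v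
    nlinarith
  -- With this scaling the polarized bound reads `2 r⁻¹ ‖Af‖² ≤ r⁻¹ ‖Af‖² + r ‖f‖²`, so one copy of
  -- `r⁻¹ ‖Af‖²` can be absorbed.
  have h := hpol (r⁻¹ • (A *ᵥ f)) f
  simp only [smul_dotProduct, dotProduct_smul, smul_eq_mul] at h
  set X := (A *ᵥ f) ⬝ᵥ (A *ᵥ f)
  have h5 : r * (r⁻¹ * (r⁻¹ * X)) = r⁻¹ * X := by field_simp
  have h6 : r⁻¹ * X ≤ r * (f ⬝ᵥ f) := by linarith [mul_add r (r⁻¹ * (r⁻¹ * X)) (f ⬝ᵥ f)]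
  calc X = r * (r⁻¹ * X) := by field_simp
    _ ≤ r * (r * (f ⬝ᵥ f)) := by gcongr
    _ = _ := by ring

theorem pow_apply_symm {A : Matrix V V ℝ} (hs : ∀ x y, A x y = A y x) (t : ℕ) (x y : V) :
    (A ^ t) x y = (A ^ t) y x := by
  have hT : Aᵀ = A := by ext i j; exact hs j i
  have : (A ^ t)ᵀ = A ^ t := by rw [Matrix.transpose_pow, hT]
  conv_lhs => rw [← this]
  rfl

theorem pow_two_mul_apply_self {A : Matrix V V ℝ} (hs : ∀ x y, A x y = A y x) (t : ℕ) (x : V) :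
    (A ^ (2 * t)) x x = (A ^ t *ᵥ Pi.single x 1) ⬝ᵥ (A ^ t *ᵥ Pi.single x 1) := by
  rw [two_mul, pow_add, Matrix.mul_apply, Matrix.mulVec_single_one]
  simp only [dotProduct, Matrix.col_apply]
  exact Finset.sum_congr rfl fun y _ => by rw [pow_apply_symm hs t x y]

theorem pow_two_mul_apply_self_le {A : Matrix V V ℝ} (hs : ∀ x y, A x y = A y x) {r : ℝ}
    (hr : 0 < r) (hA : ∀ f, |f ⬝ᵥ A *ᵥ f| ≤ r * (f ⬝ᵥ f)) (t : ℕ) (x : V) :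
    (A ^ (2 * t)) x x ≤ r ^ (2 * t) := by
  rw [pow_two_mul_apply_self hs]
  have : ∀ f : V → ℝ, (A ^ t *ᵥ f) ⬝ᵥ (A ^ t *ᵥ f) ≤ r ^ (2 * t) * (f ⬝ᵥ f) := by
    induction t with
    | zero => intro f; simp
    | succ t ih =>
      intro f
      rw [pow_succ, ← Matrix.mulVec_mulVec]
      refine (ih _).trans ?_
      calc r ^ (2 * t) * ((A *ᵥ f) ⬝ᵥ (A *ᵥ f)) ≤ r ^ (2 * t) * (r ^ 2 * (f ⬝ᵥ f)) := by
            gcongr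
            exact dotProduct_mulVec_self_le hs hr hA f
        _ = _ := by ring
  simpa using this (Pi.single x 1)

namespace IsSymmStochastic

variable {P : Matrix V V ℝ} (hP : IsSymmStochastic P)
include hP

omit [DecidableEq V] in
theorem col_sum (y : V) : ∑ x, P x y = 1 := by
  rw [← hP.row_sum y]
  exact Finset.sum_congr rfl fun x _ => hP.symm x y

omit [DecidableEq V] in
theorem mulVec_const (c : ℝ) : P *ᵥ (fun _ => c) = fun _ => c := by
  ext x
  simp [Matrix.mulVec, dotProduct, ← Finset.sum_mul, hP.row_sum]

omit [DecidableEq V] in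
theorem sum_mulVec (f : V → ℝ) : ∑ x, (P *ᵥ f) x = ∑ x, f x := by
  simp only [Matrix.mulVec, dotProduct]
  rw [Finset.sum_comm]
  simp [← Finset.sum_mul, hP.col_sum]

theorem dotProduct_one_sub_mulVec (f g : V → ℝ) :
    f ⬝ᵥ (1 - P) *ᵥ g = (∑ x, ∑ y, P x y * ((f x - f y) * (g x - g y))) / 2 := by
  have e1 : ∑ x, ∑ y, P x y * (f x * g x) = ∑ x, f x * g x := by
    simp [← Finset.sum_mul, hP.row_sum]
  have e2 : ∑ x, ∑ y, P x y * (f y * g y) = ∑ x, f x * g x := by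
    rw [Finset.sum_comm]
    simp [← Finset.sum_mul, hP.col_sum]
  have e3 : ∑ x, ∑ y, P x y * (f y * g x) = ∑ x, ∑ y, P x y * (f x * g y) := by
    rw [Finset.sum_comm]
    exact Finset.sum_congr rfl fun x _ => Finset.sum_congr rfl fun y _ => by rw [hP.symm]
  have e4 : f ⬝ᵥ P *ᵥ g = ∑ x, ∑ y, P x y * (f x * g y) := by
    simp only [dotProduct, Matrix.mulVec, Finset.mul_sum]
    exact Finset.sum_congr rfl fun x _ => Finset.sum_congr rfl fun y _ => by ring
  have e5 : ∑ x, ∑ y, P x y * ((f x - f y) * (g x - g y)) =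
      ∑ x, ∑ y, P x y * (f x * g x) - ∑ x, ∑ y, P x y * (f x * g y)
        - ∑ x, ∑ y, P x y * (f y * g x) + ∑ x, ∑ y, P x y * (f y * g y) := by
    simp only [← Finset.sum_sub_distrib, ← Finset.sum_add_distrib]
    exact Finset.sum_congr rfl fun x _ => Finset.sum_congr rfl fun y _ => by ring
  rw [e5, e1, e2, e3, Matrix.sub_mulVec, Matrix.one_mulVec, dotProduct_sub, e4]
  simp only [dotProduct]
  ring

theorem dirichlet_nonneg (f : V → ℝ) : 0 ≤ f ⬝ᵥ (1 - P) *ᵥ f := by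
  rw [hP.dotProduct_one_sub_mulVec]
  have : 0 ≤ ∑ x, ∑ y, P x y * ((f x - f y) * (f x - f y)) :=
    Finset.sum_nonneg fun x _ => Finset.sum_nonneg fun y _ =>
      mul_nonneg (hP.nonneg x y) (mul_self_nonneg _)
  linarith

theorem dirichlet_sub_const (f : V → ℝ) (c : ℝ) :
    (fun x => f x - c) ⬝ᵥ (1 - P) *ᵥ (fun x => f x - c) = f ⬝ᵥ (1 - P) *ᵥ f := by
  rw [hP.dotProduct_one_sub_mulVec, hP.dotProduct_one_sub_mulVec]
  simp

theorem dirichlet_le (f : V → ℝ) : f ⬝ᵥ (1 - P) *ᵥ f ≤ 2 * (f ⬝ᵥ f) := by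
  rw [hP.dotProduct_one_sub_mulVec]
  have e1 : ∑ x, ∑ y, P x y * (f x * f x) = f ⬝ᵥ f := by
    simp [← Finset.sum_mul, hP.row_sum, dotProduct]
  have e2 : ∑ x, ∑ y, P x y * (f y * f y) = f ⬝ᵥ f := by
    rw [Finset.sum_comm]
    simp [← Finset.sum_mul, hP.col_sum, dotProduct]
  have : ∑ x, ∑ y, P x y * ((f x - f y) * (f x - f y)) ≤
      2 * ∑ x, ∑ y, P x y * (f x * f x) + 2 * ∑ x, ∑ y, P x y * (f y * f y) := by
    simp only [Finset.mul_sum, ← Finset.sum_add_distrib]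
    refine Finset.sum_le_sum fun x _ => Finset.sum_le_sum fun y _ => ?_
    nlinarith [mul_nonneg (hP.nonneg x y) (sq_nonneg (f x + f y))]
  linarith

theorem one_sub_apply_symm (β : ℝ) (x y : V) : (1 - β • P) x y = (1 - β • P) y x := by
  simp only [Matrix.sub_apply, Matrix.smul_apply, hP.symm x y, Matrix.one_apply, eq_comm]

omit hP in
theorem dotProduct_one_sub_smul_mulVec (P : Matrix V V ℝ) (β : ℝ) (f g : V → ℝ) :
    f ⬝ᵥ (1 - β • P) *ᵥ g = β * (f ⬝ᵥ (1 - P) *ᵥ g) + (1 - β) * (f ⬝ᵥ g) := by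
  simp only [Matrix.sub_mulVec, Matrix.one_mulVec, Matrix.smul_mulVec, dotProduct_sub,
    dotProduct_smul, smul_eq_mul]
  ring

/-- A positive solution `h` of `(1 - P) h = 1` off `z` bounds the Dirichlet eigenvalue. -/
theorem dotProduct_self_le_of_supersolution {z : V} {h : V → ℝ} {H : ℝ} (hz : h z = 0)
    (hpos : ∀ x, x ≠ z → 0 < h x) (hle : ∀ x, h x ≤ H)
    (heq : ∀ x, x ≠ z → ((1 - P) *ᵥ h) x = 1) {f : V → ℝ} (hf : f z = 0) :
    f ⬝ᵥ f ≤ H * (f ⬝ᵥ (1 - P) *ᵥ f) := by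
  have hH : 0 ≤ H := hz ▸ hle z
  -- Barta's argument: the equation for `h` is tested against `f² / h`, and the Dirichlet forms are
  -- then compared edge by edge. At `z` the quotient is `0 / 0 = 0`, as needed.
  have h1 : f ⬝ᵥ f ≤ H * ((fun x => f x ^ 2 / h x) ⬝ᵥ (1 - P) *ᵥ h) := by
    simp only [dotProduct, Finset.mul_sum]
    refine Finset.sum_le_sum fun x _ => ?_
    by_cases hx : x = z
    · subst hx; simp [hf]
    · rw [heq x hx]
      have := hpos x hx
      rw [mul_one, mul_div_assoc', le_div_iff₀ this]
      nlinarith [hle x, mul_self_nonneg (f x)]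
  refine h1.trans (mul_le_mul_of_nonneg_left ?_ hH)
  rw [hP.dotProduct_one_sub_mulVec, hP.dotProduct_one_sub_mulVec]
  refine div_le_div_of_nonneg_right ?_ zero_le_two
  refine Finset.sum_le_sum fun x _ => Finset.sum_le_sum fun y _ =>
    mul_le_mul_of_nonneg_left ?_ (hP.nonneg x y)
  by_cases hx : x = z
  · subst hx
    by_cases hy : y = x
    · subst hy; simp
    · have := hpos y hy
      rw [hz, hf]
      apply le_of_eq
      field_simp
      ring
  · by_cases hy : y = z
    · subst hy
      have := hpos x hx
      rw [hz, hf]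
      apply le_of_eq
      field_simp
      ring
    · have h2 := hpos x hx
      have h3 := hpos y hy
      have : (f x - f y) * (f x - f y) - (f x ^ 2 / h x - f y ^ 2 / h y) * (h x - h y) =
          (f x * h y - f y * h x) ^ 2 / (h x * h y) := by
        field_simp
        ring
      have h4 : 0 ≤ (f x * h y - f y * h x) ^ 2 / (h x * h y) := by positivity
      linarith

end IsSymmStochastic

omit [DecidableEq V] in
theorem sum_sub_mean [Nonempty V] (f : V → ℝ) :
    ∑ x, (f x - (∑ y, f y) / Fintype.card V) = 0 := by
  have : (Fintype.card V : ℝ) ≠ 0 := by positivity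
  simp [Finset.sum_sub_distrib]
  field_simp
  ring

omit [DecidableEq V] in
theorem dotProduct_sub_mean_add [Nonempty V] (f : V → ℝ) (c : ℝ) :
    (fun x => f x - c) ⬝ᵥ (fun x => f x - c) =
    (fun x => f x - (∑ y, f y) / Fintype.card V) ⬝ᵥ (fun x => f x - (∑ y, f y) / Fintype.card V)
      + Fintype.card V * ((∑ y, f y) / Fintype.card V - c) ^ 2 := by
  have hn : (Fintype.card V : ℝ) ≠ 0 := by positivity
  have key := sum_sub_mean f
  set m := (∑ y, f y) / Fintype.card V
  simp only [dotProduct]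
  have : ∀ x, (f x - c) * (f x - c) =
      (f x - m) * (f x - m) + (m - c) ^ 2 + 2 * (m - c) * (f x - m) := fun x => by ring
  simp only [this, Finset.sum_add_distrib, ← Finset.mul_sum, key]
  simp

end SymmStochastic

/-! ### First-step analysis of hitting times. -/

section HittingTime

variable {Ω : Type*} [Fintype Ω] [DecidableEq Ω]

theorem avoidProb_zero (P : Matrix Ω Ω ℝ) (x y : Ω) :
    avoidProb P x y 0 = if x = y then 0 else 1 := by
  rw [avoidProb, Finset.sum_filter, Finset.sum_eq_single fun _ => x]
  · by_cases h : x = y <;> simp [h]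
  · intro ω _ hω
    refine if_neg fun h => hω (funext fun i => ?_)
    rw [Fin.fin_one_eq_zero i]
    exact h.1
  · simp

theorem avoidProb_succ (P : Matrix Ω Ω ℝ) (x y : Ω) (t : ℕ) :
    avoidProb P x y (t + 1) = if x = y then 0 else ∑ z, P x z * avoidProb P z y t := by
  rw [avoidProb, Finset.sum_filter, ← (Fin.consEquiv fun _ : Fin (t + 2) => Ω).sum_comp,
    Fintype.sum_prod_type, Finset.sum_eq_single x]
  · split_ifs with h
    · refine Finset.sum_eq_zero fun ω _ => if_neg fun hω => ?_
      exact hω.2 0 (by simpa using h)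
    · simp only [avoidProb, Finset.sum_filter, Finset.mul_sum]
      rw [Finset.sum_comm]
      refine Finset.sum_congr rfl fun ω _ => ?_
      rw [Finset.sum_eq_single (ω 0)]
      · simp only [Fin.consEquiv_apply, Fin.cons_zero, true_and, Fin.forall_fin_succ (n := t + 1),
          Fin.cons_succ, ne_eq, h, not_false_eq_true, mul_ite, mul_zero]
        refine if_congr Iff.rfl ?_ rfl
        rw [Fin.prod_univ_succ]
        simp
      · intro b _ hb
        simp [hb.symm]
      · simp
  · intro b _ hb
    refine Finset.sum_eq_zero fun ω _ => if_neg fun hω => hb ?_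
    simpa using hω.1
  · simp

theorem avoidProb_nonneg {P : Matrix Ω Ω ℝ} (hP : ∀ x y, 0 ≤ P x y) (x y : Ω) (t : ℕ) :
    0 ≤ avoidProb P x y t :=
  Finset.sum_nonneg fun _ _ => Finset.prod_nonneg fun _ _ => hP _ _

theorem expectedHittingTime_self (P : Matrix Ω Ω ℝ) (y : Ω) : expectedHittingTime P y y = 0 := by
  rw [expectedHittingTime, ENNReal.tsum_eq_zero]
  rintro (_ | t)
  · simp [avoidProb_zero]
  · simp [avoidProb_succ]

theorem expectedHittingTime_of_ne {P : Matrix Ω Ω ℝ} (hP : ∀ x y, 0 ≤ P x y) {x y : Ω}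
    (hxy : x ≠ y) :
    expectedHittingTime P x y = 1 + ∑ z, ENNReal.ofReal (P x z) * expectedHittingTime P z y := by
  rw [expectedHittingTime, tsum_eq_zero_add' ENNReal.summable, avoidProb_zero, if_neg hxy,
    ENNReal.ofReal_one]
  congr 1
  simp only [expectedHittingTime, ← ENNReal.tsum_mul_left]
  rw [← Summable.tsum_finsetSum fun _ _ => ENNReal.summable]
  refine tsum_congr fun t => ?_
  rw [avoidProb_succ, if_neg hxy, ENNReal.ofReal_sum_of_nonneg
    fun z _ => mul_nonneg (hP x z) (avoidProb_nonneg hP z y t)]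
  exact Finset.sum_congr rfl fun z _ => ENNReal.ofReal_mul (hP x z)

theorem expectedHittingTime_le_maxHittingTime (P : Matrix Ω Ω ℝ) (x y : Ω) :
    expectedHittingTime P x y ≤ maxHittingTime P :=
  le_iSup₂_of_le x y le_rfl

end HittingTime

/-! ### Green kernels of killed walks and spectral bounds. -/

section SymmStochastic

open Matrix Finset

variable {V : Type*} [Fintype V] [DecidableEq V]

namespace IsSymmStochastic

variable {P : Matrix V V ℝ} (hP : IsSymmStochastic P)
include hP

/-- The expected hitting times as a real function, when they are bounded. -/
theorem exists_hitting_function {H : ℝ} (hH0 : 0 ≤ H)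
    (hH : maxHittingTime P ≤ ENNReal.ofReal H) (z : V) :
    ∃ h : V → ℝ, h z = 0 ∧ (∀ x, x ≠ z → 1 ≤ h x) ∧ (∀ x, h x ≤ H) ∧
      ∀ x, x ≠ z → ((1 - P) *ᵥ h) x = 1 := by
  have hfin : ∀ x, expectedHittingTime P x z ≠ ⊤ := fun x =>
    (((expectedHittingTime_le_maxHittingTime P x z).trans hH).trans_lt ENNReal.ofReal_lt_top).ne
  have hrec : ∀ x, x ≠ z → (expectedHittingTime P x z).toReal =
      1 + ∑ y, P x y * (expectedHittingTime P y z).toReal := by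
    intro x hx
    rw [expectedHittingTime_of_ne hP.nonneg hx, ENNReal.toReal_add ENNReal.one_ne_top,
      ENNReal.toReal_sum]
    · simp [ENNReal.toReal_mul, ENNReal.toReal_ofReal (hP.nonneg _ _)]
    · intro y _
      exact ENNReal.mul_ne_top ENNReal.ofReal_ne_top (hfin y)
    · exact ENNReal.sum_ne_top.2 fun y _ => ENNReal.mul_ne_top ENNReal.ofReal_ne_top (hfin y)
  refine ⟨fun x => (expectedHittingTime P x z).toReal, ?_, fun x hx => ?_,
    fun x => ?_, fun x hx => ?_⟩
  · simp [expectedHittingTime_self]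
  · dsimp only
    rw [hrec x hx]
    have : 0 ≤ ∑ y, P x y * (expectedHittingTime P y z).toReal :=
      Finset.sum_nonneg fun y _ => mul_nonneg (hP.nonneg x y) ENNReal.toReal_nonneg
    linarith
  · refine ENNReal.toReal_le_of_le_ofReal hH0 ?_
    exact (expectedHittingTime_le_maxHittingTime P x z).trans hH
  · rw [Matrix.sub_mulVec, Matrix.one_mulVec, Pi.sub_apply, hrec x hx]
    simp [Matrix.mulVec, dotProduct]

/-- Minimum principle: at a minimum `z` of `v` one has `v z ≤ (P v) z`, so the hypothesis forces `(1
- β) v z ≥ 0`. Invertibility of `1 - β • P` and positivity of its inverse follow from it. -/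
theorem nonneg_of_one_sub_smul_mulVec_nonneg {β : ℝ} (h0 : 0 ≤ β) (h1 : β < 1) {v : V → ℝ}
    (hv : ∀ x, 0 ≤ ((1 - β • P) *ᵥ v) x) (x : V) : 0 ≤ v x := by
  obtain ⟨z, -, hz⟩ := Finset.exists_min_image Finset.univ v ⟨x, Finset.mem_univ x⟩
  refine le_trans ?_ (hz x (Finset.mem_univ x))
  have h2 := hv z
  rw [Matrix.sub_mulVec, Matrix.one_mulVec, Matrix.smul_mulVec, Pi.sub_apply, Pi.smul_apply,
    smul_eq_mul] at h2
  have h3 : v z ≤ (P *ᵥ v) z := by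
    simp only [Matrix.mulVec, dotProduct]
    calc v z = ∑ y, P z y * v z := by rw [← Finset.sum_mul, hP.row_sum, one_mul]
      _ ≤ _ := Finset.sum_le_sum fun y _ =>
        mul_le_mul_of_nonneg_left (hz y (Finset.mem_univ y)) (hP.nonneg z y)
  nlinarith

theorem isUnit_one_sub_smul {β : ℝ} (h0 : 0 ≤ β) (h1 : β < 1) : IsUnit (1 - β • P) := by
  rw [← Matrix.mulVec_injective_iff_isUnit]
  intro u v huv
  have key : ∀ u v : V → ℝ, (1 - β • P) *ᵥ u = (1 - β • P) *ᵥ v → ∀ x, v x ≤ u x := by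
    intro u v huv x
    have := hP.nonneg_of_one_sub_smul_mulVec_nonneg h0 h1 (v := u - v)
      (by rw [Matrix.mulVec_sub, huv]; simp) x
    simpa using this
  exact funext fun x => le_antisymm (key v u huv.symm x) (key u v huv x)

theorem one_sub_smul_mul_inv {β : ℝ} (h0 : 0 ≤ β) (h1 : β < 1) :
    (1 - β • P) * (1 - β • P)⁻¹ = 1 :=
  Matrix.mul_nonsing_inv _ ((Matrix.isUnit_iff_isUnit_det _).1 (hP.isUnit_one_sub_smul h0 h1))

theorem inv_mul_one_sub_smul {β : ℝ} (h0 : 0 ≤ β) (h1 : β < 1) :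
    (1 - β • P)⁻¹ * (1 - β • P) = 1 :=
  Matrix.nonsing_inv_mul _ ((Matrix.isUnit_iff_isUnit_det _).1 (hP.isUnit_one_sub_smul h0 h1))

theorem resolvent_nonneg {β : ℝ} (h0 : 0 ≤ β) (h1 : β < 1) (x y : V) :
    0 ≤ (1 - β • P)⁻¹ x y := by
  have := hP.nonneg_of_one_sub_smul_mulVec_nonneg h0 h1 (v := (1 - β • P)⁻¹ *ᵥ Pi.single y 1)
    (by
      intro z
      rw [Matrix.mulVec_mulVec, hP.one_sub_smul_mul_inv h0 h1, Matrix.one_mulVec]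
      by_cases h : z = y
      · subst h; simp
      · simp [h]) x
  simpa using this

theorem resolvent_symm (β : ℝ) (x y : V) :
    (1 - β • P)⁻¹ x y = (1 - β • P)⁻¹ y x := by
  have hT : (1 - β • P)ᵀ = 1 - β • P := by
    ext i j
    exact hP.one_sub_apply_symm β j i
  have : ((1 - β • P)⁻¹)ᵀ = (1 - β • P)⁻¹ := by rw [Matrix.transpose_nonsing_inv, hT]
  conv_lhs => rw [← this]
  rfl

theorem resolvent_row_sum {β : ℝ} (h0 : 0 ≤ β) (h1 : β < 1) (x : V) :
    ∑ y, (1 - β • P)⁻¹ x y = (1 - β)⁻¹ := by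
  have hb : 1 - β ≠ 0 := by linarith
  have e : (1 - β • P) *ᵥ (fun _ => (1 - β)⁻¹) = fun _ => 1 := by
    ext z
    rw [Matrix.sub_mulVec, Matrix.one_mulVec, Matrix.smul_mulVec, hP.mulVec_const]
    simp only [Pi.sub_apply, Pi.smul_apply, smul_eq_mul]
    field_simp
  have e2 : (1 - β • P)⁻¹ *ᵥ (fun _ => (1 : ℝ)) = fun _ => (1 - β)⁻¹ := by
    rw [← e, Matrix.mulVec_mulVec, hP.inv_mul_one_sub_smul h0 h1, Matrix.one_mulVec]
  have := congrFun e2 x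
  simpa [Matrix.mulVec, dotProduct] using this

/-- Since the form of `1 - P` is at most `2 ‖v‖²`, the killing term `(1 - β) ‖v‖²` makes up for half
of the missing `(1 - β)` share. The constant does not depend on `β`. -/
theorem dirichlet_le_two_mul {β : ℝ} (h0 : 0 ≤ β) (h1 : β < 1) (v : V → ℝ) :
    v ⬝ᵥ (1 - P) *ᵥ v ≤ 2 * (v ⬝ᵥ (1 - β • P) *ᵥ v) := by
  rw [dotProduct_one_sub_smul_mulVec]
  nlinarith [hP.dirichlet_le v, hP.dirichlet_nonneg v]

theorem one_sub_smul_nonneg {β : ℝ} (h0 : 0 ≤ β) (h1 : β < 1) (v : V → ℝ) :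
    0 ≤ v ⬝ᵥ (1 - β • P) *ᵥ v := by
  linarith [hP.dirichlet_le_two_mul h0 h1 v, hP.dirichlet_nonneg v]

/-- The Green function of the killed walk on the diagonal is controlled by any solution `w` of the
Poisson equation. -/
theorem resolvent_self_le [Nonempty V] {β : ℝ} (h0 : 0 ≤ β) (h1 : β < 1) {y : V} {w : V → ℝ}
    (hw0 : ∑ x, w x = 0)
    (hw : (1 - P) *ᵥ w = fun x => (Pi.single y 1 : V → ℝ) x - 1 / (Fintype.card V : ℝ)) :
    (1 - β • P)⁻¹ y y ≤ (1 - β)⁻¹ / Fintype.card V + 2 * w y := by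
  have hn : (Fintype.card V : ℝ) ≠ 0 := by positivity
  have hb : 1 - β ≠ 0 := by linarith
  set n : ℝ := (Fintype.card V : ℝ) with hn_def
  set u : V → ℝ := fun x => (Pi.single y 1 : V → ℝ) x - 1 / n with hu
  set v : V → ℝ := fun x => (1 - β • P)⁻¹ x y - (1 - β)⁻¹ / n with hv
  have hv0 : ∑ x, v x = 0 := by
    have : ∑ x, (1 - β • P)⁻¹ x y = (1 - β)⁻¹ := by
      rw [← hP.resolvent_row_sum h0 h1 y]
      exact Finset.sum_congr rfl fun x _ => hP.resolvent_symm β x y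
    simp only [hv, Finset.sum_sub_distrib, this, Finset.sum_const, Finset.card_univ,
      nsmul_eq_mul, ← hn_def]
    field_simp
    ring
  have hdot : ∀ f : V → ℝ, ∑ x, f x = 0 → f ⬝ᵥ u = f y := by
    intro f hf
    simp [hu, dotProduct, mul_sub, Finset.sum_sub_distrib, ← Finset.sum_mul, hf, Pi.single_apply]
  have hAv : (1 - β • P) *ᵥ v = u := by
    have e : v = (1 - β • P)⁻¹ *ᵥ Pi.single y 1 - fun _ => (1 - β)⁻¹ / n := by
      ext x
      simp [hv]
    rw [e, Matrix.mulVec_sub, Matrix.mulVec_mulVec, hP.one_sub_smul_mul_inv h0 h1,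
      Matrix.one_mulVec, Matrix.sub_mulVec (1 : Matrix V V ℝ), Matrix.one_mulVec,
      Matrix.smul_mulVec, hP.mulVec_const]
    ext x
    simp only [hu, Pi.sub_apply, Pi.smul_apply, smul_eq_mul]
    field_simp
  have hs : ∀ x z, (1 - P) x z = (1 - P) z x := by
    simpa using hP.one_sub_apply_symm 1
  -- Both `v` and `w` have mean zero, so pairing with `u` evaluates them at `y`. This gives `v y ^ 2
  -- ≤ ℰ(v) * w y ≤ 2 * v y * w y`, where `ℰ` is the form of `1 - P`.
  have hCS := sq_dotProduct_mulVec_le hs hP.dirichlet_nonneg v w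
  rw [hw, hdot v hv0, hdot w hw0] at hCS
  have h2 := hP.dirichlet_le_two_mul h0 h1 v
  rw [hAv, hdot v hv0] at h2
  have h3 := hP.dirichlet_nonneg w
  rw [hw, hdot w hw0] at h3
  have h4 := hP.dirichlet_nonneg v
  have h5 : v y ≤ 2 * w y := by
    have : v y ^ 2 ≤ (2 * v y) * w y := hCS.trans (mul_le_mul_of_nonneg_right h2 h3)
    by_contra! hlt
    nlinarith
  simp only [hv] at h5
  linarith

/-- Expand `f` in an orthonormal eigenbasis. By `hconst`, basis vectors with eigenvalue `1` are
constant, hence orthogonal to `f`; the other eigenvalues obey `hr`. -/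
theorem abs_dotProduct_mulVec_le_of_eigenvalues {r : ℝ}
    (hconst : ∀ f : V → ℝ, P *ᵥ f = f → ∀ x y, f x = f y)
    (hr : ∀ μ : ℝ, Module.End.HasEigenvalue (Matrix.toLin' P) μ → μ ≠ 1 → |μ| ≤ r)
    {f : V → ℝ} (hf : ∑ x, f x = 0) : |f ⬝ᵥ P *ᵥ f| ≤ r * (f ⬝ᵥ f) := by
  have hA : P.IsHermitian := by
    ext i j
    simpa using hP.symm j i
  set b := hA.eigenvectorBasis
  set c : V → ℝ := fun i => f ⬝ᵥ (b i).ofLp with hc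
  have hin : ∀ u v : V → ℝ, inner ℝ (WithLp.toLp 2 u : EuclideanSpace ℝ V) (WithLp.toLp 2 v) =
      u ⬝ᵥ v := by
    intro u v
    rw [EuclideanSpace.inner_eq_star_dotProduct, dotProduct_comm]
    simp
  have hparseval : ∀ u v : V → ℝ,
      ∑ i, (u ⬝ᵥ (b i).ofLp) * ((b i).ofLp ⬝ᵥ v) = u ⬝ᵥ v := by
    intro u v
    rw [← hin u v, ← b.sum_inner_mul_inner]
    exact Finset.sum_congr rfl fun i _ => by rw [← hin, ← hin]
  have hPb : ∀ i, (b i).ofLp ⬝ᵥ P *ᵥ f = hA.eigenvalues i * c i := by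
    intro i
    rw [Matrix.dotProduct_mulVec, ← Matrix.mulVec_transpose]
    have : Pᵀ = P := by ext i j; exact hP.symm j i
    rw [this, hA.mulVec_eigenvectorBasis, smul_dotProduct, dotProduct_comm]
    rfl
  have e1 : f ⬝ᵥ P *ᵥ f = ∑ i, hA.eigenvalues i * c i ^ 2 := by
    rw [← hparseval]
    exact Finset.sum_congr rfl fun i _ => by rw [hPb]; ring
  have e2 : f ⬝ᵥ f = ∑ i, c i ^ 2 := by
    rw [← hparseval]
    exact Finset.sum_congr rfl fun i _ => by rw [dotProduct_comm _ f]; ring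
  rw [e1, e2, Finset.mul_sum]
  refine (Finset.abs_sum_le_sum_abs _ _).trans (Finset.sum_le_sum fun i _ => ?_)
  rw [abs_mul, abs_of_nonneg (sq_nonneg (c i))]
  by_cases h1 : hA.eigenvalues i = 1
  · have hPi := hA.mulVec_eigenvectorBasis i
    rw [h1, one_smul] at hPi
    have hi := hconst _ hPi
    have : c i = 0 := by
      rcases isEmpty_or_nonempty V with hV | ⟨⟨z⟩⟩
      · simp [hc, dotProduct]
      · have : c i = ∑ x, f x * (b i).ofLp z := Finset.sum_congr rfl fun x _ => by
          congr 1
          exact hi x z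
        rw [this, ← Finset.sum_mul, hf, zero_mul]
    simp [this]
  · refine mul_le_mul_of_nonneg_right (hr _ ?_ h1) (sq_nonneg _)
    refine Module.End.hasEigenvalue_of_hasEigenvector (x := (b i).ofLp) ⟨?_, ?_⟩
    · rw [Module.End.mem_eigenspace_iff, Matrix.toLin'_apply]
      exact hA.mulVec_eigenvectorBasis i
    · intro h0
      refine b.orthonormal.ne_zero i ?_
      ext x
      exact congrFun h0 x

/-- Subtracting the projection `J` onto constants removes the eigenvalue `1`. The identity `(P -
J)^k = P^k - J` needs `k ≥ 1`, whence `t ≠ 0`. -/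
theorem pow_two_mul_apply_self_le_of_eigenvalues [Nonempty V] {r : ℝ} (hr0 : 0 < r)
    (hgap : ∀ f : V → ℝ, ∑ x, f x = 0 → |f ⬝ᵥ P *ᵥ f| ≤ r * (f ⬝ᵥ f))
    {t : ℕ} (ht : t ≠ 0) (x : V) :
    (P ^ (2 * t)) x x ≤ 1 / Fintype.card V + r ^ (2 * t) := by
  have hn : (Fintype.card V : ℝ) ≠ 0 := by positivity
  set J : Matrix V V ℝ := Matrix.of fun _ _ => 1 / (Fintype.card V : ℝ) with hJ
  have hPJ : P * J = J := by
    ext i j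
    simp [Matrix.mul_apply, hJ, ← Finset.sum_mul, hP.row_sum]
  have hJP : J * P = J := by
    ext i j
    simp [Matrix.mul_apply, hJ, ← Finset.mul_sum, hP.col_sum]
  have hJJ : J * J = J := by
    ext i j
    simp [Matrix.mul_apply, hJ]
  have hpow : ∀ k : ℕ, (P - J) ^ (k + 1) = P ^ (k + 1) - J := by
    intro k
    induction k with
    | zero => simp
    | succ k ih =>
      have : P ^ (k + 1) * J = J := by
        clear ih
        induction k with
        | zero => simpa using hPJ
        | succ k ih => rw [pow_succ, Matrix.mul_assoc, hPJ, ih]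
      rw [pow_succ, ih, Matrix.sub_mul, Matrix.mul_sub, Matrix.mul_sub, this, hJP, hJJ,
        ← pow_succ]
      abel
  have hform : ∀ f : V → ℝ, |f ⬝ᵥ (P - J) *ᵥ f| ≤ r * (f ⬝ᵥ f) := by
    intro f
    set m := (∑ y, f y) / Fintype.card V with hm
    have h1 := hgap _ (sum_sub_mean f)
    have h2 := dotProduct_sub_mean_add f 0
    simp only [sub_zero] at h2
    rw [← hm] at h1 h2
    have h3 : f ⬝ᵥ (P - J) *ᵥ f = (fun x => f x - m) ⬝ᵥ P *ᵥ (fun x => f x - m) := by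
      have e0 : J *ᵥ f = fun _ => m := by
        ext z
        simp only [Matrix.mulVec, dotProduct, hJ, Matrix.of_apply, ← Finset.mul_sum, hm]
        ring
      have e1 : (fun x => f x - m) = f - fun _ => m := rfl
      have e2 : f ⬝ᵥ (fun _ : V => m) = Fintype.card V * m ^ 2 := by
        simp only [dotProduct, ← Finset.sum_mul, hm]
        field_simp
      have e3 : (fun _ : V => m) ⬝ᵥ P *ᵥ f = Fintype.card V * m ^ 2 := by
        simp only [dotProduct, ← Finset.mul_sum, hP.sum_mulVec, hm]
        field_simp
      have e4 : (fun _ : V => m) ⬝ᵥ (fun _ : V => m) = Fintype.card V * m ^ 2 := by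
        simp [dotProduct]
        ring
      rw [Matrix.sub_mulVec, dotProduct_sub, e0, e1, Matrix.mulVec_sub, hP.mulVec_const,
        dotProduct_sub, sub_dotProduct, sub_dotProduct, e2, e3, e4]
      ring
    rw [h3]
    refine h1.trans (mul_le_mul_of_nonneg_left ?_ hr0.le)
    rw [h2]
    have : 0 ≤ (Fintype.card V : ℝ) * (m - 0) ^ 2 := by positivity
    simp only [sub_zero] at this
    linarith
  have hs : ∀ x y, (P - J) x y = (P - J) y x := fun x y => by
    simp [hP.symm x y, hJ]
  have := pow_two_mul_apply_self_le hs hr0 hform t x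
  obtain ⟨k, hk⟩ : ∃ k, 2 * t = k + 1 := ⟨2 * t - 1, by omega⟩
  rw [hk, hpow, Matrix.sub_apply] at this
  rw [hk]
  simp only [hJ, Matrix.of_apply] at this
  linarith

end IsSymmStochastic

end SymmStochastic

/-! ### Low-energy subsets and the sum over killed walks. -/

section SymmStochastic

open Matrix Finset

variable {V : Type*} [Fintype V] [DecidableEq V]

/-- The matrix `P` with the rows and columns of `S` set to zero. -/
def killedMatrix (P : Matrix V V ℝ) (S : Finset V) : Matrix V V ℝ :=
  Matrix.of fun x y => if x ∈ S ∨ y ∈ S then 0 else P x y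

omit [Fintype V] in
theorem killedMatrix_empty (P : Matrix V V ℝ) : killedMatrix P ∅ = P := by
  ext x y
  simp [killedMatrix]

/-- If every nonempty `S` has a nonempty subset `T` with `S ⊆ h T` and `a S ≤ q ^ #T`, where
`#(h T) ≤ r * #T`, then the sum of `a` is at most that of a binomial series. -/
theorem sum_nonempty_le_of_hull {a : Finset V → ℝ} {h : Finset V → Finset V} {q r : ℝ}
    (hq : 0 ≤ q) (hcard : ∀ T, T.Nonempty → ((h T).card : ℝ) ≤ r * T.card)
    (ha : ∀ S : Finset V, S.Nonempty → ∃ T : Finset V, T.Nonempty ∧ S ⊆ h T ∧ a S ≤ q ^ T.card) :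
    ∑ S with S.Nonempty, a S ≤ (1 + Real.exp r * q) ^ Fintype.card V - 1 := by
  -- The chosen `T` is replaced by a sum over all `T` whose hull contains `S`. After exchanging
  -- sums, each `T` is counted at most `2 ^ #(h T) ≤ exp (r * #T)` times.
  have h1 : ∀ S ∈ (univ.filter Finset.Nonempty : Finset (Finset V)), a S ≤
      ∑ T with T.Nonempty, if S ⊆ h T then q ^ T.card else 0 := by
    intro S hS
    obtain ⟨T, hT, hST, haT⟩ := ha S (Finset.mem_filter.1 hS).2
    refine haT.trans ?_
    have := Finset.single_le_sum (s := (univ.filter Finset.Nonempty : Finset (Finset V)))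
      (f := fun T => if S ⊆ h T then q ^ T.card else 0)
      (fun T _ => by positivity) (Finset.mem_filter.2 ⟨Finset.mem_univ T, hT⟩)
    simpa [hST] using this
  refine (Finset.sum_le_sum h1).trans ?_
  rw [Finset.sum_comm]
  have h2 : ∀ T ∈ (univ.filter Finset.Nonempty : Finset (Finset V)),
      (∑ S with S.Nonempty, if S ⊆ h T then q ^ T.card else 0) ≤ (Real.exp r * q) ^ T.card := by
    intro T hT
    have hT' := (Finset.mem_filter.1 hT).2
    calc (∑ S with S.Nonempty, if S ⊆ h T then q ^ T.card else 0)
        ≤ ∑ S, if S ⊆ h T then q ^ T.card else 0 :=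
          Finset.sum_le_sum_of_subset_of_nonneg (Finset.filter_subset _ _)
            fun S _ _ => by positivity
      _ = 2 ^ (h T).card * q ^ T.card := by
          rw [← Finset.sum_filter, Finset.sum_const, nsmul_eq_mul]
          have : (univ.filter fun S => S ⊆ h T) = (h T).powerset := by
            ext S
            simp
          rw [this, Finset.card_powerset]
          push_cast
          rfl
      _ ≤ Real.exp r ^ T.card * q ^ T.card := by
          refine mul_le_mul_of_nonneg_right ?_ (by positivity)
          calc (2 : ℝ) ^ (h T).card ≤ Real.exp 1 ^ (h T).card := by
                gcongr
                linarith [Real.add_one_le_exp 1]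
            _ = Real.exp (h T).card := by rw [← Real.exp_nat_mul, mul_one]
            _ ≤ Real.exp (T.card * r) := by
                rw [Real.exp_le_exp, mul_comm]
                exact hcard T hT'
            _ = Real.exp r ^ T.card := Real.exp_nat_mul _ _
      _ = _ := by rw [mul_pow]
  refine (Finset.sum_le_sum h2).trans ?_
  have h3 := Fintype.sum_pow_mul_eq_add_pow V (Real.exp r * q) 1
  simp only [one_pow, mul_one] at h3
  rw [add_comm, ← h3]
  have h4 : (univ.filter Finset.Nonempty : Finset (Finset V)) = univ.erase ∅ := by
    ext T
    simp [Finset.nonempty_iff_ne_empty]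
  rw [h4, ← Finset.add_sum_erase _ _ (Finset.mem_univ (∅ : Finset V))]
  simp

omit [Fintype V] in
/-- A set of limited size contains a subset of small energy outside which the potential is
small. -/
theorem exists_low_energy_subset {G : V → V → ℝ} {D : ℝ} {J : ℕ}
    (hsymm : ∀ x y, G x y = G y x) (hD : ∀ x, G x x ≤ D) (hJ : 0 < J) {S : Finset V}
    (hS : S.Nonempty) :
    ∃ T ⊆ S, T.Nonempty ∧ T.card ≤ J ∧ ∑ y ∈ T, ∑ z ∈ T, G y z ≤ (D + 2) * T.card ∧
      (T.card < J → ∀ y ∈ S, y ∉ T → 1 < ∑ z ∈ T, G y z) := by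
  obtain ⟨x, hx⟩ := hS
  set F := S.powerset.filter fun T => T.Nonempty ∧ T.card ≤ J ∧
    ∑ y ∈ T, ∑ z ∈ T, G y z ≤ (D + 2) * T.card with hF
  have hxF : {x} ∈ F := by
    simp only [hF, Finset.mem_filter, Finset.mem_powerset, Finset.singleton_subset_iff, hx,
      Finset.singleton_nonempty, Finset.card_singleton, Finset.sum_singleton, true_and]
    refine ⟨hJ, ?_⟩
    push_cast
    linarith [hD x]
  obtain ⟨T, hTF, hmax⟩ := Finset.exists_max_image F Finset.card ⟨_, hxF⟩
  simp only [hF, Finset.mem_filter, Finset.mem_powerset] at hTF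
  obtain ⟨hTS, hT, hTJ, hE⟩ := hTF
  refine ⟨T, hTS, hT, hTJ, hE, fun hlt y hy hyT => ?_⟩
  by_contra! hle
  -- Adding `y` raises the energy by `G y y` plus twice its potential from `T`, hence by at most `D
  -- + 2` if that potential is at most `1`; this would contradict the maximality of `T`.
  have hnot : insert y T ∈ F := by
    simp only [hF, Finset.mem_filter, Finset.mem_powerset]
    refine ⟨Finset.insert_subset hy hTS, Finset.insert_nonempty _ _, ?_, ?_⟩
    · rw [Finset.card_insert_of_notMem hyT]
      exact hlt
    · rw [Finset.sum_insert hyT, Finset.sum_insert hyT, Finset.card_insert_of_notMem hyT]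
      have e : ∑ w ∈ T, ∑ z ∈ insert y T, G w z =
          ∑ z ∈ T, G y z + ∑ w ∈ T, ∑ z ∈ T, G w z := by
        rw [← Finset.sum_add_distrib]
        exact Finset.sum_congr rfl fun w _ => by rw [Finset.sum_insert hyT, hsymm w y]
      rw [e]
      push_cast
      linarith [hD y]
  have := hmax _ hnot
  rw [Finset.card_insert_of_notMem hyT] at this
  omega

-- Markov's inequality for the potential of `T`, whose total mass is `R * #T`.
omit [DecidableEq V] in
theorem card_filter_one_lt_sum_le {G : V → V → ℝ} (hG : ∀ x y, 0 ≤ G x y) {R : ℝ}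
    (hR : ∀ z, ∑ y, G y z = R) (T : Finset V) :
    ((univ.filter fun y => 1 < ∑ z ∈ T, G y z).card : ℝ) ≤ R * T.card := by
  calc ((univ.filter fun y => 1 < ∑ z ∈ T, G y z).card : ℝ)
      = ∑ y with 1 < ∑ z ∈ T, G y z, (1 : ℝ) := by simp
    _ ≤ ∑ y with 1 < ∑ z ∈ T, G y z, ∑ z ∈ T, G y z :=
        Finset.sum_le_sum fun y hy => (Finset.mem_filter.1 hy).2.le
    _ ≤ ∑ y, ∑ z ∈ T, G y z :=
        Finset.sum_le_sum_of_subset_of_nonneg (Finset.filter_subset _ _)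
          fun y _ _ => Finset.sum_nonneg fun z _ => hG y z
    _ = R * T.card := by
        rw [Finset.sum_comm]
        simp [hR, mul_comm]

namespace IsSymmStochastic

variable {P : Matrix V V ℝ} (hP : IsSymmStochastic P)
include hP

theorem abs_dotProduct_killedMatrix_mulVec_le {S T : Finset V} (hTS : T ⊆ S) {ε : ℝ}
    (hε : ∀ f : V → ℝ, (∀ z ∈ T, f z = 0) → ε * (f ⬝ᵥ f) ≤ f ⬝ᵥ (1 - P) *ᵥ f) (f : V → ℝ) :
    |f ⬝ᵥ killedMatrix P S *ᵥ f| ≤ Real.exp (-ε) * (f ⬝ᵥ f) := by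
  -- Absolute values reduce a two-sided bound to a one-sided one, so negative eigenvalues of the
  -- killed matrix need no separate estimate.
  set g : V → ℝ := fun x => if x ∈ S then 0 else |f x| with hg
  have h1 : |f ⬝ᵥ killedMatrix P S *ᵥ f| ≤ g ⬝ᵥ P *ᵥ g := by
    simp only [dotProduct, Matrix.mulVec, Finset.mul_sum]
    refine (Finset.abs_sum_le_sum_abs _ _).trans (Finset.sum_le_sum fun x _ => ?_)
    refine (Finset.abs_sum_le_sum_abs _ _).trans (Finset.sum_le_sum fun y _ => ?_)
    by_cases hx : x ∈ S <;> by_cases hy : y ∈ S <;>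
      simp [hg, killedMatrix, hx, hy, abs_mul, abs_of_nonneg (hP.nonneg x y)]
  have h2 := hε g fun z hz => by simp [hg, hTS hz]
  rw [Matrix.sub_mulVec, Matrix.one_mulVec, dotProduct_sub] at h2
  have h3 : g ⬝ᵥ g ≤ f ⬝ᵥ f := by
    simp only [dotProduct]
    refine Finset.sum_le_sum fun x _ => ?_
    by_cases hx : x ∈ S
    · simp [hg, hx, mul_self_nonneg]
    · simp [hg, hx]
  have h4 : 0 ≤ g ⬝ᵥ g := Finset.sum_nonneg fun x _ => mul_self_nonneg _
  calc |f ⬝ᵥ killedMatrix P S *ᵥ f| ≤ (1 - ε) * (g ⬝ᵥ g) := by linarith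
    _ ≤ Real.exp (-ε) * (g ⬝ᵥ g) :=
        mul_le_mul_of_nonneg_right (by linarith [Real.add_one_le_exp (-ε)]) h4
    _ ≤ _ := mul_le_mul_of_nonneg_left h3 (Real.exp_pos _).le

/-- Sets of small energy have a large Dirichlet eigenvalue. -/
theorem dotProduct_self_le_of_energy [Nonempty V] {R : ℝ} (hR : 1 ≤ R)
    (hgap : ∀ f : V → ℝ, ∑ x, f x = 0 → f ⬝ᵥ f ≤ R * (f ⬝ᵥ (1 - P) *ᵥ f))
    {T : Finset V} (hT : T.Nonempty) {C : ℝ}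
    (hE : ∑ y ∈ T, ∑ z ∈ T, (1 - (1 - R⁻¹) • P)⁻¹ y z ≤ C * T.card)
    {f : V → ℝ} (hf : ∀ z ∈ T, f z = 0) :
    f ⬝ᵥ f ≤ (2 * C * (Fintype.card V / T.card) + R) * (f ⬝ᵥ (1 - P) *ᵥ f) := by
  have hR0 : 0 < R := by linarith
  have hRinv : R⁻¹ ≤ 1 := inv_le_one_of_one_le₀ hR
  have hRpos : 0 < R⁻¹ := inv_pos.2 hR0
  have h0 : 0 ≤ 1 - R⁻¹ := by linarith
  have h1 : 1 - R⁻¹ < 1 := by linarith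
  set β := 1 - R⁻¹ with hβ
  have hj : (0 : ℝ) < T.card := by exact_mod_cast hT.card_pos
  set m := (∑ y, f y) / Fintype.card V with hm
  set h : V → ℝ := fun x => f x - m with hh
  set E := f ⬝ᵥ (1 - P) *ᵥ f with hEdef
  have hE0 : 0 ≤ E := hP.dirichlet_nonneg f
  have hEh : h ⬝ᵥ (1 - P) *ᵥ h = E := hP.dirichlet_sub_const f m
  have hgaph := hgap h (sum_sub_mean f)
  rw [hEh] at hgaph
  -- The killing rate `1 - β = R⁻¹` matches the spectral gap, so on mean-zero functions killing at
  -- most doubles the energy.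
  have hform : h ⬝ᵥ (1 - β • P) *ᵥ h ≤ 2 * E := by
    rw [dotProduct_one_sub_smul_mulVec, hEh]
    have e : (1 - β) * (h ⬝ᵥ h) ≤ E := by
      have : 1 - β = R⁻¹ := by rw [hβ]; ring
      rw [this, inv_mul_le_iff₀ hR0]
      exact hgaph
    nlinarith
  set i : V → ℝ := fun x => if x ∈ T then 1 else 0 with hi
  set u := (1 - β • P)⁻¹ *ᵥ i with hu
  have hAu : (1 - β • P) *ᵥ u = i := by
    rw [hu, Matrix.mulVec_mulVec, hP.one_sub_smul_mul_inv h0 h1, Matrix.one_mulVec]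
  have hui : u ⬝ᵥ i ≤ C * T.card := by
    refine le_trans (le_of_eq ?_) hE
    simp [hu, hi, dotProduct, Matrix.mulVec]
  have hhi : h ⬝ᵥ i = -(m * T.card) := by
    have : h ⬝ᵥ i = ∑ x ∈ T, h x := by simp [hi, dotProduct]
    rw [this, Finset.sum_congr rfl fun x hx => show h x = -m by simp [hh, hf x hx]]
    simp
    ring
  -- As `h = -m` on `T`, pairing `h` with the indicator of `T`, which is `(1 - β • P) u`, gives `-m
  -- * #T`. Cauchy–Schwarz thus bounds the mean `m` of `f` by the energies of `h` and of the
  -- potential `u`.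
  have hCS := sq_dotProduct_mulVec_le (hP.one_sub_apply_symm β) (hP.one_sub_smul_nonneg h0 h1) h u
  have hu0 := hP.one_sub_smul_nonneg h0 h1 u
  rw [hAu] at hu0
  rw [hAu, hhi] at hCS
  have hm2 : m ^ 2 * T.card ≤ 2 * C * E := by
    have : (m ^ 2 * T.card) * T.card ≤ (2 * C * E) * T.card := by
      calc (m ^ 2 * T.card) * T.card = (-(m * T.card)) ^ 2 := by ring
        _ ≤ _ := hCS
        _ ≤ (2 * E) * (C * T.card) := mul_le_mul hform hui hu0 (by linarith)
        _ = _ := by ring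
    exact le_of_mul_le_mul_right this hj
  have hdecomp := dotProduct_sub_mean_add f 0
  simp only [sub_zero] at hdecomp
  rw [← hm] at hdecomp
  have hm3 : Fintype.card V * m ^ 2 ≤ 2 * C * (Fintype.card V / T.card) * E := by
    have : m ^ 2 ≤ 2 * C * E / T.card := by rwa [le_div_iff₀ hj]
    calc Fintype.card V * m ^ 2 ≤ Fintype.card V * (2 * C * E / T.card) := by gcongr
      _ = _ := by ring
  rw [hdecomp, add_mul]
  change h ⬝ᵥ h + _ ≤ _
  linarith

theorem killedMatrix_symm (S : Finset V) (x y : V) :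
    killedMatrix P S x y = killedMatrix P S y x := by
  simp only [killedMatrix, Matrix.of_apply, hP.symm x y, or_comm]

/-- The total return probability of the walks killed on nonempty sets. -/
theorem sum_killedMatrix_pow_le [Nonempty V] {κ R : ℝ} (hR : 1 ≤ R)
    (hRκ : R ≤ κ * Fintype.card V)
    (hgap : ∀ f : V → ℝ, ∑ x, f x = 0 → f ⬝ᵥ f ≤ R * (f ⬝ᵥ (1 - P) *ᵥ f))
    (hdiag : ∀ y, (1 - (1 - R⁻¹) • P)⁻¹ y y ≤ 3 * κ) (t : ℕ) (x : V) :
    ∑ S with S.Nonempty, (killedMatrix P S ^ (2 * t)) x x ≤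
      (1 + Real.exp (1 + R) * Real.exp (-(2 * t / ((7 * κ + 5) * Fintype.card V)))) ^
        Fintype.card V - 1 := by
  have hn : (0 : ℝ) < Fintype.card V := by positivity
  set n : ℝ := (Fintype.card V : ℝ) with hn_def
  have hR0 : 0 < R := by linarith
  have hκ : 0 < κ := by
    by_contra! hle
    nlinarith
  have hRinv : R⁻¹ ≤ 1 := inv_le_one_of_one_le₀ hR
  have hRpos : 0 < R⁻¹ := inv_pos.2 hR0
  have h0 : 0 ≤ 1 - R⁻¹ := by linarith
  have h1 : 1 - R⁻¹ < 1 := by linarith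
  set G := (1 - (1 - R⁻¹) • P)⁻¹ with hG
  -- From `J` points on, a hull of size `R * #T` may be all of `V`. Stopping at `J` keeps `R ≤ (1 +
  -- κ) n / #T`, so the gap term `R` does not spoil the eigenvalue bound.
  set J := ⌈n / R⌉₊ with hJ
  have hJpos : 0 < J := Nat.ceil_pos.2 (by positivity)
  have hJn : n ≤ R * J := by
    have := Nat.le_ceil (n / R)
    rw [div_le_iff₀ hR0] at this
    linarith
  have hJle : R * J ≤ (1 + κ) * n := by
    have := Nat.ceil_lt_add_one (a := n / R) (by positivity)
    have h2 : R * J ≤ R * (n / R + 1) := by gcongr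
    have h3 : R * (n / R + 1) = n + R := by field_simp
    linarith
  have hGsum : ∀ z, ∑ y, G y z = R := by
    intro z
    rw [Finset.sum_congr rfl fun y _ => hP.resolvent_symm (1 - R⁻¹) y z,
      hP.resolvent_row_sum h0 h1]
    simp
  refine sum_nonempty_le_of_hull
    (h := fun T => if T.card < J then T ∪ univ.filter fun y => 1 < ∑ z ∈ T, G y z else univ)
    (Real.exp_pos _).le ?_ ?_
  · intro T hT
    have hT1 : (0 : ℝ) ≤ T.card := by positivity
    split_ifs with hc
    · have h2 := card_filter_one_lt_sum_le (hP.resolvent_nonneg h0 h1) hGsum T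
      have h3 : ((T ∪ univ.filter fun y => 1 < ∑ z ∈ T, G y z).card : ℝ) ≤
          T.card + (univ.filter fun y => 1 < ∑ z ∈ T, G y z).card := by
        exact_mod_cast Finset.card_union_le _ _
      linarith
    · rw [Finset.card_univ]
      have : (J : ℝ) ≤ T.card := by exact_mod_cast not_lt.1 hc
      nlinarith
  · intro S hS
    obtain ⟨T, hTS, hT, hTJ, hE, hclose⟩ :=
      exists_low_energy_subset (hP.resolvent_symm (1 - R⁻¹)) hdiag hJpos hS
    refine ⟨T, hT, ?_, ?_⟩
    · split_ifs with hc
      · intro y hy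
        by_cases hyT : y ∈ T
        · exact Finset.mem_union_left _ hyT
        · exact Finset.mem_union_right _
            (Finset.mem_filter.2 ⟨Finset.mem_univ y, hclose hc y hy hyT⟩)
      · exact Finset.subset_univ _
    · have hj : (0 : ℝ) < T.card := by exact_mod_cast hT.card_pos
      have hjJ : (T.card : ℝ) ≤ J := by exact_mod_cast hTJ
      have hA : 0 < 7 * κ + 5 := by linarith
      -- The constant is `2 (3κ + 2)` from the energy bound plus `1 + κ` from the bound on `R`.
      set ε := T.card / ((7 * κ + 5) * n) with hε
      have hε0 : 0 < ε := by positivity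
      have hgap' : ∀ f : V → ℝ, (∀ z ∈ T, f z = 0) → ε * (f ⬝ᵥ f) ≤ f ⬝ᵥ (1 - P) *ᵥ f := by
        intro f hf
        have h2 := hP.dotProduct_self_le_of_energy hR hgap hT hE hf
        have h3 : 2 * (3 * κ + 2) * (n / T.card) + R ≤ ε⁻¹ := by
          rw [hε, inv_div]
          have : R ≤ (1 + κ) * n / T.card := by
            rw [le_div_iff₀ hj]
            nlinarith
          have e : (7 * κ + 5) * n / T.card =
            2 * (3 * κ + 2) * (n / T.card) + (1 + κ) * n / T.card := by ring
          linarith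
        have h4 := h2.trans (mul_le_mul_of_nonneg_right h3 (hP.dirichlet_nonneg f))
        rwa [← div_eq_inv_mul, le_div_iff₀ hε0, mul_comm] at h4
      have h2 := pow_two_mul_apply_self_le (hP.killedMatrix_symm S) (Real.exp_pos (-ε))
        (hP.abs_dotProduct_killedMatrix_mulVec_le hTS hgap') t x
      refine h2.trans (le_of_eq ?_)
      rw [← Real.exp_nat_mul, ← Real.exp_nat_mul, hε]
      congr 1
      push_cast
      ring

end IsSymmStochastic

end SymmStochastic

/-! ### The `L²` distance as a return probability. -/

section L2

open Matrix Finset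

variable {Ω : Type*} [Fintype Ω] [DecidableEq Ω]

theorem l2Dist_eq_sqrt [Nonempty Ω] {Q : Matrix Ω Ω ℝ} (hs : ∀ x y, Q x y = Q y x)
    {t : ℕ} {x : Ω} (hsum : ∑ y, (Q ^ t) x y = 1) :
    l2Dist Q x t = Real.sqrt (Fintype.card Ω * (Q ^ (2 * t)) x x - 1) := by
  have hn : (Fintype.card Ω : ℝ) ≠ 0 := by positivity
  have h1 : (Q ^ (2 * t)) x x = ∑ y, (Q ^ t) x y ^ 2 := by
    rw [pow_two_mul_apply_self hs, Matrix.mulVec_single_one]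
    simp only [dotProduct, Matrix.col_apply]
    exact Finset.sum_congr rfl fun y _ => by rw [pow_apply_symm hs t y x, sq]
  rw [l2Dist, h1]
  congr 1
  have h2 : ∀ y, ((Q ^ t) x y / (Fintype.card Ω : ℝ)⁻¹ - 1) ^ 2 * (Fintype.card Ω : ℝ)⁻¹ =
      Fintype.card Ω * (Q ^ t) x y ^ 2 - 2 * (Q ^ t) x y + (Fintype.card Ω : ℝ)⁻¹ := by
    intro y
    field_simp
    ring
  simp only [h2, Finset.sum_add_distrib, Finset.sum_sub_distrib, ← Finset.mul_sum, hsum,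
    Finset.sum_const, Finset.card_univ, nsmul_eq_mul]
  field_simp
  ring

end L2

/-! ### Fourier decomposition of the lamplighter walk. -/

section Lamplighter

open Matrix Finset

variable {V : Type*} [Fintype V] [DecidableEq V]

/-- The character `f ↦ (-1)^{#{z ∈ S | f z}}` of the lamp group. -/
def lampCharacter (S : Finset V) (f : V → Bool) : ℝ := ∏ z ∈ S, if f z then -1 else 1

/-- The product of a lamp character and a function of the position. -/
def lampProduct (S : Finset V) (g : V → ℝ) (a : LampState V) : ℝ := lampCharacter S a.1 * g a.2

omit [Fintype V] in
theorem lampCharacter_update_add (S : Finset V) (f : V → Bool) (x : V) :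
    lampCharacter S (Function.update f x true) + lampCharacter S (Function.update f x false) =
      if x ∈ S then 0 else 2 * lampCharacter S f := by
  have hne : ∀ (U : Finset V) b, x ∉ U →
      lampCharacter U (Function.update f x b) = lampCharacter U f := by
    intro U b hU
    refine Finset.prod_congr rfl fun z hz => ?_
    rw [Function.update_of_ne (ne_of_mem_of_not_mem hz hU)]
  split_ifs with hx
  · have : ∀ b, lampCharacter S (Function.update f x b) =
        (if b then -1 else 1) * lampCharacter (S.erase x) f := by
      intro b
      rw [← hne (S.erase x) b (Finset.notMem_erase x S), lampCharacter,
        ← Finset.mul_prod_erase S _ hx]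
      simp [lampCharacter]
    rw [this, this]
    simp
  · rw [hne S _ hx, hne S _ hx]
    ring

omit [DecidableEq V] in
theorem sum_lampCharacter_mul (f g : V → Bool) :
    ∑ S, lampCharacter S f * lampCharacter S g = if f = g then 2 ^ Fintype.card V else 0 := by
  have h := Finset.prod_one_add
    (f := fun z => (if f z then (-1 : ℝ) else 1) * (if g z then -1 else 1)) (univ : Finset V)
  rw [Finset.powerset_univ] at h
  simp only [lampCharacter, ← Finset.prod_mul_distrib]
  rw [← h]
  split_ifs with hfg
  · subst hfg
    rw [← Finset.card_univ, ← Finset.prod_const]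
    refine Finset.prod_congr rfl fun z _ => ?_
    cases f z <;> norm_num
  · obtain ⟨z, hz⟩ := Function.ne_iff.1 hfg
    refine Finset.prod_eq_zero (Finset.mem_univ z) ?_
    revert hz
    cases f z <;> cases g z <;> simp

theorem lampRandomize_mulVec_lampProduct (S : Finset V) (g : V → ℝ) :
    lampRandomize *ᵥ lampProduct S g = lampProduct S fun x => if x ∈ S then 0 else g x := by
  ext ⟨f, x⟩
  have hset : (univ.filter fun f' : V → Bool => ∀ z, z ≠ x → f z = f' z) =
      {Function.update f x true, Function.update f x false} := by
    ext f'
    simp only [Finset.mem_filter, Finset.mem_univ, true_and, Finset.mem_insert,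
      Finset.mem_singleton]
    constructor
    · intro h
      have : f' = Function.update f x (f' x) := by
        ext z
        by_cases hz : z = x
        · subst hz; simp
        · rw [Function.update_of_ne hz, h z hz]
      cases hb : f' x
      · right; rwa [hb] at this
      · left; rwa [hb] at this
    · rintro (h | h) z hz <;> rw [h, Function.update_of_ne hz]
  have hne : Function.update f x true ≠ Function.update f x false := by
    intro h
    simpa using congrFun h x
  have h1 : (lampRandomize *ᵥ lampProduct S g) (f, x) =
      ∑ f' with ∀ z, z ≠ x → f z = f' z, 1 / 2 * (lampCharacter S f' * g x) := by
    simp only [Matrix.mulVec, dotProduct, Fintype.sum_prod_type, lampRandomize, Matrix.of_apply,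
      lampProduct, Finset.sum_filter]
    refine Finset.sum_congr rfl fun f' _ => ?_
    rw [Finset.sum_eq_single x]
    · by_cases h : ∀ z, z ≠ x → f z = f' z
      · simp only [true_and]
        rw [if_pos h, if_pos h]
      · simp only [true_and]
        rw [if_neg h, if_neg h, zero_mul]
    · intro y _ hy
      rw [if_neg fun h => hy h.1.symm, zero_mul]
    · simp
  rw [h1, hset, Finset.sum_pair hne, ← mul_add, ← add_mul, lampCharacter_update_add]
  simp only [lampProduct]
  split_ifs <;> ring

theorem lampMove_mulVec_lampProduct (P : Matrix V V ℝ) (S : Finset V) (g : V → ℝ) :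
    lampMove P *ᵥ lampProduct S g = lampProduct S (P *ᵥ g) := by
  ext ⟨f, x⟩
  simp only [Matrix.mulVec, dotProduct, Fintype.sum_prod_type, lampMove, Matrix.of_apply,
    lampProduct]
  rw [Finset.sum_eq_single f]
  · simp only [if_true, Finset.mul_sum]
    exact Finset.sum_congr rfl fun y _ => by ring
  · intro f' _ hf'
    simp [hf'.symm]
  · simp

/-- The two randomizations kill the function at the old and at the new position when these lie in
`S`; this produces the zero rows and the zero columns. -/
theorem lamplighterMatrix_mulVec_lampProduct (G : UGraph V) (S : Finset V) (g : V → ℝ) :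
    G.lamplighterMatrix *ᵥ lampProduct S g =
      lampProduct S (killedMatrix G.walkMatrix S *ᵥ g) := by
  rw [UGraph.lamplighterMatrix, ← Matrix.mulVec_mulVec, ← Matrix.mulVec_mulVec,
    lampRandomize_mulVec_lampProduct, lampMove_mulVec_lampProduct,
    lampRandomize_mulVec_lampProduct]
  congr 1
  ext x
  simp only [Matrix.mulVec, dotProduct, killedMatrix, Matrix.of_apply]
  split_ifs with hx
  · simp [hx]
  · refine Finset.sum_congr rfl fun y _ => ?_
    by_cases hy : y ∈ S <;> simp [hx, hy]

theorem lamplighterMatrix_pow_mulVec_lampProduct (G : UGraph V) (S : Finset V) (t : ℕ)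
    (g : V → ℝ) :
    G.lamplighterMatrix ^ t *ᵥ lampProduct S g =
      lampProduct S (killedMatrix G.walkMatrix S ^ t *ᵥ g) := by
  induction t generalizing g with
  | zero => simp
  | succ t ih =>
    rw [pow_succ, ← Matrix.mulVec_mulVec, lamplighterMatrix_mulVec_lampProduct, ih,
      Matrix.mulVec_mulVec, ← pow_succ]

/-- The return probabilities of the lamplighter walk are averages of those of killed walks. -/
theorem lamplighterMatrix_pow_apply_self (G : UGraph V) (t : ℕ) (a : LampState V) :
    2 ^ Fintype.card V * (G.lamplighterMatrix ^ t) a a =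
      ∑ S, (killedMatrix G.walkMatrix S ^ t) a.2 a.2 := by
  -- Fourier inversion in the lamp variable.
  have hδ : (2 ^ Fintype.card V : ℝ) • (Pi.single a 1 : LampState V → ℝ) =
      ∑ S, lampCharacter S a.1 • lampProduct S (Pi.single a.2 1) := by
    ext b
    simp only [Pi.smul_apply, smul_eq_mul, Finset.sum_apply, lampProduct, ← mul_assoc,
      ← Finset.sum_mul, sum_lampCharacter_mul]
    obtain ⟨f, x⟩ := a
    obtain ⟨g, y⟩ := b
    by_cases hxy : y = x
    · subst hxy
      by_cases hfg : f = g
      · subst hfg; simp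
      · have : ((g, y) : LampState V) ≠ (f, y) := by simpa [eq_comm] using hfg
        rw [Pi.single_eq_of_ne this]
        simp [hfg]
    · simp [hxy]
  have h1 := congrFun (congrArg (fun v => G.lamplighterMatrix ^ t *ᵥ v) hδ) a
  simp only [Matrix.mulVec_smul, Matrix.mulVec_sum, lamplighterMatrix_pow_mulVec_lampProduct,
    Pi.smul_apply, smul_eq_mul, Finset.sum_apply, Matrix.mulVec_single_one, Matrix.col_apply,
    lampProduct] at h1
  rw [h1]
  refine Finset.sum_congr rfl fun S _ => ?_
  have : lampCharacter S a.1 * lampCharacter S a.1 = 1 := by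
    rw [lampCharacter, ← Finset.prod_mul_distrib]
    exact Finset.prod_eq_one fun z _ => by split_ifs <;> norm_num
  rw [← mul_assoc, this, one_mul]

theorem lampRandomize_symm (a b : LampState V) :
    lampRandomize a b = lampRandomize b a := by
  simp only [lampRandomize, Matrix.of_apply]
  refine if_congr ?_ rfl rfl
  constructor <;> rintro ⟨h1, h2⟩ <;>
    exact ⟨h1.symm, fun z hz => (h2 z (h1 ▸ hz)).symm⟩

theorem lamplighterMatrix_symm {G : UGraph V}
    (hs : ∀ x y, G.walkMatrix x y = G.walkMatrix y x) (a b : LampState V) :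
    G.lamplighterMatrix a b = G.lamplighterMatrix b a := by
  have hR : (lampRandomize : Matrix (LampState V) (LampState V) ℝ)ᵀ = lampRandomize := by
    ext a b
    exact lampRandomize_symm b a
  have hM : (lampMove G.walkMatrix)ᵀ = lampMove G.walkMatrix := by
    ext a b
    simp only [Matrix.transpose_apply, lampMove, Matrix.of_apply, hs b.2 a.2, eq_comm]
  have : (G.lamplighterMatrix)ᵀ = G.lamplighterMatrix := by
    rw [UGraph.lamplighterMatrix, Matrix.transpose_mul, Matrix.transpose_mul, hR, hM,
      Matrix.mul_assoc]
  conv_lhs => rw [← this]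
  rfl

theorem sum_lamplighterMatrix_pow {G : UGraph V} (hP : IsSymmStochastic G.walkMatrix) (t : ℕ)
    (a : LampState V) : ∑ b, (G.lamplighterMatrix ^ t) a b = 1 := by
  have h : (lampProduct ∅ fun _ : V => (1 : ℝ)) = fun _ => 1 := by
    ext b
    simp [lampProduct, lampCharacter]
  have h1 : G.lamplighterMatrix ^ t *ᵥ (fun _ => (1 : ℝ)) = fun _ => 1 := by
    rw [← h, lamplighterMatrix_pow_mulVec_lampProduct, killedMatrix_empty]
    congr 1
    induction t with
    | zero => simp
    | succ t ih => rw [pow_succ, ← Matrix.mulVec_mulVec, hP.mulVec_const, ih]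
  simpa [Matrix.mulVec, dotProduct] using congrFun h1 a

theorem l2Dist_lamplighterMatrix [Nonempty V] {G : UGraph V} (hP : IsSymmStochastic G.walkMatrix)
    (t : ℕ) (a : LampState V) :
    l2Dist G.lamplighterMatrix a t = Real.sqrt (Fintype.card V *
      ∑ S, (killedMatrix G.walkMatrix S ^ (2 * t)) a.2 a.2 - 1) := by
  rw [l2Dist_eq_sqrt (lamplighterMatrix_symm hP.symm) (sum_lamplighterMatrix_pow hP t a),
    ← lamplighterMatrix_pow_apply_self]
  congr 2
  simp only [Fintype.card_prod, Fintype.card_fun, Fintype.card_bool]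
  push_cast
  ring

end Lamplighter

/-! ### Consequences of the hitting time bound, and assembly. -/

section SymmStochastic

open Matrix Finset

variable {V : Type*} [Fintype V] [DecidableEq V]

namespace IsSymmStochastic

variable {P : Matrix V V ℝ} (hP : IsSymmStochastic P)
include hP

theorem dotProduct_sub_self_le_of_maxHittingTime_le {H : ℝ} (hH0 : 0 ≤ H)
    (hH : maxHittingTime P ≤ ENNReal.ofReal H) (f : V → ℝ) (z : V) :
    (fun x => f x - f z) ⬝ᵥ (fun x => f x - f z) ≤ H * (f ⬝ᵥ (1 - P) *ᵥ f) := by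
  obtain ⟨h, hz, hpos, hle, heq⟩ := hP.exists_hitting_function hH0 hH z
  rw [← hP.dirichlet_sub_const f (f z)]
  exact hP.dotProduct_self_le_of_supersolution hz (fun x hx => by linarith [hpos x hx]) hle heq
    (sub_self _)

theorem dotProduct_self_le_of_maxHittingTime_le [Nonempty V] {H : ℝ} (hH0 : 0 ≤ H)
    (hH : maxHittingTime P ≤ ENNReal.ofReal H) {f : V → ℝ} (hf : ∑ x, f x = 0) :
    f ⬝ᵥ f ≤ H * (f ⬝ᵥ (1 - P) *ᵥ f) := by
  obtain ⟨z⟩ := ‹Nonempty V›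
  have h1 := hP.dotProduct_sub_self_le_of_maxHittingTime_le hH0 hH f z
  have h2 := @dotProduct_sub_mean_add V _ ⟨z⟩ f (f z)
  simp only [hf, zero_div, sub_zero] at h2
  have : 0 ≤ (Fintype.card V : ℝ) * (0 - f z) ^ 2 := by positivity
  have e : (fun x => f x) ⬝ᵥ (fun x => f x) = f ⬝ᵥ f := rfl
  linarith

/-- A harmonic function has zero Dirichlet energy, so its distance to the constant `f y` vanishes.
Finite hitting times thus play the role of irreducibility. -/
theorem eq_of_mulVec_eq_self {H : ℝ} (hH0 : 0 ≤ H)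
    (hH : maxHittingTime P ≤ ENNReal.ofReal H) {f : V → ℝ} (hf : P *ᵥ f = f) (x y : V) :
    f x = f y := by
  have h1 := hP.dotProduct_sub_self_le_of_maxHittingTime_le hH0 hH f y
  rw [Matrix.sub_mulVec, hf, Matrix.one_mulVec, sub_self, dotProduct_zero, mul_zero] at h1
  have h2 := (Finset.sum_eq_zero_iff_of_nonneg fun x _ => mul_self_nonneg (f x - f y)).1
    (le_antisymm h1 (Finset.sum_nonneg fun x _ => mul_self_nonneg (f x - f y))) x
    (Finset.mem_univ x)
  exact sub_eq_zero.1 (mul_self_eq_zero.1 h2)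

theorem one_le_of_maxHittingTime_le [Nontrivial V] {H : ℝ} (hH0 : 0 ≤ H)
    (hH : maxHittingTime P ≤ ENNReal.ofReal H) : 1 ≤ H := by
  obtain ⟨x, z, hxz⟩ := exists_pair_ne V
  obtain ⟨h, -, hpos, hle, -⟩ := hP.exists_hitting_function hH0 hH z
  exact (hpos x hxz).trans (hle x)

/-- The hitting times of `y`, centred and divided by `-n`, solve the Poisson equation with source
`δ_y - 1/n`, and their value at `y` is the mean hitting time over `n`. -/
theorem resolvent_self_le_of_maxHittingTime_le [Nonempty V] {H : ℝ} (hH0 : 0 ≤ H)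
    (hH : maxHittingTime P ≤ ENNReal.ofReal H) {β : ℝ} (h0 : 0 ≤ β) (h1 : β < 1) (y : V) :
    (1 - β • P)⁻¹ y y ≤ (1 - β)⁻¹ / Fintype.card V + 2 * (H / Fintype.card V) := by
  have hn : (0 : ℝ) < Fintype.card V := by positivity
  obtain ⟨h, hy, -, hle, heq⟩ := hP.exists_hitting_function hH0 hH y
  set m := (∑ x, h x) / Fintype.card V with hm
  have hmH : m ≤ H := by
    rw [hm, div_le_iff₀ hn]
    calc ∑ x, h x ≤ ∑ _x : V, H := Finset.sum_le_sum fun x _ => hle x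
      _ = _ := by simp [mul_comm]
  set w : V → ℝ := fun x => -(h x - m) / Fintype.card V with hw
  have hw0 : ∑ x, w x = 0 := by
    simp only [hw, ← Finset.sum_div, Finset.sum_neg_distrib, hm, sum_sub_mean]
    simp
  have hwy : w y ≤ H / Fintype.card V := by
    simp only [hw, hy]
    gcongr
    linarith
  -- The entries of `(1 - P) h` sum to zero and equal `1` off `y`, which fixes the one at `y`.
  have hself : ((1 - P) *ᵥ h) y = 1 - Fintype.card V := by
    have hs : ∑ x, ((1 - P) *ᵥ h) x = 0 := by
      simp [Matrix.sub_mulVec, Finset.sum_sub_distrib, hP.sum_mulVec]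
    rw [← Finset.add_sum_erase _ _ (Finset.mem_univ y),
      Finset.sum_congr rfl fun x hx => heq x (Finset.ne_of_mem_erase hx)] at hs
    simp only [Finset.sum_const, Finset.card_erase_of_mem (Finset.mem_univ y), Finset.card_univ,
      nsmul_eq_mul, mul_one] at hs
    rw [Nat.cast_sub Fintype.card_pos] at hs
    push_cast at hs
    linarith
  have hPw : (1 - P) *ᵥ w = fun x => (Pi.single y 1 : V → ℝ) x - 1 / (Fintype.card V : ℝ) := by
    have e : w = (-(Fintype.card V : ℝ)⁻¹) • (h - fun _ => m) := by
      ext x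
      simp only [hw, Pi.smul_apply, Pi.sub_apply, smul_eq_mul]
      ring
    have ec : (1 - P) *ᵥ (fun _ => m) = 0 := by
      rw [Matrix.sub_mulVec, hP.mulVec_const, Matrix.one_mulVec, sub_self]
    rw [e, Matrix.mulVec_smul, Matrix.mulVec_sub, ec, sub_zero]
    ext x
    rw [Pi.smul_apply, smul_eq_mul]
    by_cases hx : x = y
    · subst hx
      rw [hself, Pi.single_eq_same]
      field_simp
      ring
    · rw [heq x hx, Pi.single_eq_of_ne hx]
      ring
  have := hP.resolvent_self_le h0 h1 hw0 hPw
  linarith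

omit hP in
theorem abs_eigenvalue_le {T : ℝ} (hT : relaxationTime P = ENNReal.ofReal T) {μ : ℝ}
    (hμ : Module.End.HasEigenvalue (Matrix.toLin' P) μ) (h1 : μ ≠ 1) : 1 ≤ T ∧ |μ| ≤ 1 - T⁻¹ := by
  have h2 : (ENNReal.ofReal (1 - |μ|))⁻¹ ≤ ENNReal.ofReal T := by
    rw [← hT]
    exact le_iSup₂_of_le (f := fun (μ : ℝ)
      (_ : Module.End.HasEigenvalue (Matrix.toLin' P) μ ∧ μ ≠ 1) => (ENNReal.ofReal (1 - |μ|))⁻¹)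
      μ ⟨hμ, h1⟩ le_rfl
  have h3 : 0 < 1 - |μ| := by
    by_contra! hle
    rw [ENNReal.ofReal_of_nonpos hle, ENNReal.inv_zero] at h2
    exact ENNReal.ofReal_ne_top (top_le_iff.1 h2)
  rw [← ENNReal.ofReal_inv_of_pos h3] at h2
  have h4 : (1 - |μ|)⁻¹ ≤ T := by
    have h5 : 0 < (1 - |μ|)⁻¹ := inv_pos.2 h3
    have h6 : 0 < T := ENNReal.ofReal_pos.1 ((ENNReal.ofReal_pos.2 h5).trans_le h2)
    exact (ENNReal.ofReal_le_ofReal_iff h6.le).1 h2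
  have h5 : 1 ≤ (1 - |μ|)⁻¹ := (one_le_inv₀ h3).2 (by linarith [abs_nonneg μ])
  refine ⟨h5.trans h4, ?_⟩
  have := inv_anti₀ (by linarith) h4
  rw [inv_inv] at this
  linarith

theorem one_le_relaxationTime [Nontrivial V]
    (hconst : ∀ f : V → ℝ, P *ᵥ f = f → ∀ x y, f x = f y)
    {T : ℝ} (hT : relaxationTime P = ENNReal.ofReal T) : 1 ≤ T := by
  by_contra! hlt
  obtain ⟨x, y, hxy⟩ := exists_pair_ne V
  set f : V → ℝ := Pi.single x 1 - Pi.single y 1 with hf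
  -- If `T < 1` there is no eigenvalue other than `1`, so the spectral bound holds vacuously even
  -- with `r = -1`, which is absurd for the nonzero mean-zero `f`.
  have h := hP.abs_dotProduct_mulVec_le_of_eigenvalues (r := -1) hconst
    (fun μ hμ h1 => absurd (abs_eigenvalue_le hT hμ h1).1 (not_le.2 hlt)) (f := f)
    (by simp [hf, Finset.sum_sub_distrib])
  have h2 : f x * f x ≤ f ⬝ᵥ f :=
    Finset.single_le_sum (fun z _ => mul_self_nonneg (f z)) (Finset.mem_univ x)
  have h3 : f x = 1 := by simp [hf, hxy]
  have h4 := abs_nonneg (f ⬝ᵥ P *ᵥ f)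
  rw [h3] at h2
  linarith

/-- The bound on the exponential moment of the number of unvisited vertices, in terms of killed
walks. -/
theorem card_mul_sum_killedMatrix_le [Nontrivial V] {κ : ℝ} (hκ : 0 < κ)
    (hH : maxHittingTime P ≤ ENNReal.ofReal (κ * Fintype.card V))
    {T : ℝ} (hT : relaxationTime P = ENNReal.ofReal T) {t : ℕ}
    (ht : (35 * κ + 25) * Fintype.card V * (T + Real.log (Fintype.card V)) ≤ t) (x : V) :
    Fintype.card V * ∑ S, (killedMatrix P S ^ (2 * t)) x x - 1 ≤ 1 / 16 := by
  have hn1 : (1 : ℝ) ≤ Fintype.card V := by exact_mod_cast Fintype.card_pos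
  set n : ℝ := (Fintype.card V : ℝ) with hn
  have hn0 : 0 < n := by linarith
  have hκn : 0 ≤ κ * n := by positivity
  have hL : 0 ≤ Real.log n := Real.log_nonneg hn1
  have hconst : ∀ f : V → ℝ, P *ᵥ f = f → ∀ x y, f x = f y :=
    fun f hf => hP.eq_of_mulVec_eq_self hκn hH hf
  have hT1 := hP.one_le_relaxationTime hconst hT
  have hT0 : 0 < T := by linarith
  have hspec : ∀ f : V → ℝ, ∑ x, f x = 0 → |f ⬝ᵥ P *ᵥ f| ≤ (1 - T⁻¹) * (f ⬝ᵥ f) := fun f hf =>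
    hP.abs_dotProduct_mulVec_le_of_eigenvalues hconst
      (fun μ hμ h1 => (abs_eigenvalue_le hT hμ h1).2) hf
  have hff : ∀ f : V → ℝ, 0 ≤ f ⬝ᵥ f := fun f => Finset.sum_nonneg fun x _ => mul_self_nonneg _
  -- Both entries bound the inverse spectral gap. The second keeps `R / n ≤ κ`, as the Green kernel
  -- bound requires.
  set R := min T (κ * n) with hR
  have hR1 : 1 ≤ R := le_min hT1 (hP.one_le_of_maxHittingTime_le hκn hH)
  have hRT : R ≤ T := min_le_left _ _
  have hRκ : R ≤ κ * n := min_le_right _ _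
  have hgap : ∀ f : V → ℝ, ∑ x, f x = 0 → f ⬝ᵥ f ≤ R * (f ⬝ᵥ (1 - P) *ᵥ f) := by
    intro f hf
    rw [hR]
    rcases min_choice T (κ * n) with h | h <;> rw [h]
    · have h1 := (abs_le.1 (hspec f hf)).2
      have h2 : T⁻¹ * (f ⬝ᵥ f) ≤ f ⬝ᵥ (1 - P) *ᵥ f := by
        rw [Matrix.sub_mulVec, Matrix.one_mulVec, dotProduct_sub]
        linarith
      rwa [inv_mul_le_iff₀ hT0] at h2
    · exact hP.dotProduct_self_le_of_maxHittingTime_le hκn hH hf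
  have hRinv : R⁻¹ ≤ 1 := inv_le_one_of_one_le₀ hR1
  have hRpos : 0 < R⁻¹ := inv_pos.2 (by linarith)
  have hdiag : ∀ y, (1 - (1 - R⁻¹) • P)⁻¹ y y ≤ 3 * κ := by
    intro y
    have h1 := hP.resolvent_self_le_of_maxHittingTime_le hκn hH (β := 1 - R⁻¹) (by linarith)
      (by linarith) y
    rw [sub_sub_cancel, inv_inv, ← hn, mul_div_cancel_right₀ _ hn0.ne'] at h1
    have h2 : R / n ≤ κ := by rwa [div_le_iff₀ hn0]
    linarith
  have hsum := hP.sum_killedMatrix_pow_le hR1 hRκ hgap hdiag t x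
  rw [← hn] at hsum
  set w := Real.exp (1 + R) * Real.exp (-(2 * t / ((7 * κ + 5) * n))) with hw
  have htpos : 25 * n * T ≤ t := by
    refine le_trans ?_ ht
    have : 0 ≤ 35 * κ * n * T := by positivity
    have : 0 ≤ (35 * κ + 25) * n * Real.log n := by positivity
    nlinarith
  -- Since `35κ + 25 = 5 (7κ + 5)`, the exponent is at least `10 (R + log n)`, and `1 + R - 10 R ≤
  -- -8` because `R ≥ 1`.
  have hwle : w ≤ (1 / 256) * (n ^ 10)⁻¹ := by
    have h1 : 10 * (R + Real.log n) ≤ 2 * t / ((7 * κ + 5) * n) := by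
      rw [le_div_iff₀ (by positivity)]
      have : (35 * κ + 25) * n * (R + Real.log n) ≤ (35 * κ + 25) * n * (T + Real.log n) := by
        gcongr
      nlinarith
    calc w ≤ Real.exp (-8 + (-(10 * Real.log n))) := by
          rw [hw, ← Real.exp_add, Real.exp_le_exp]
          linarith
      _ = Real.exp (-8) * (n ^ 10)⁻¹ := by
          rw [Real.exp_add, Real.exp_neg (10 * _)]
          congr 2
          rw [← Real.exp_log (pow_pos hn0 10), Real.log_pow]
          push_cast
          rfl
      _ ≤ _ := by
          gcongr
          have h2 : (256 : ℝ) ≤ Real.exp 8 := by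
            calc (256 : ℝ) = 2 ^ 8 := by norm_num
              _ ≤ Real.exp 1 ^ 8 := by
                gcongr
                linarith [Real.add_one_le_exp 1]
              _ = Real.exp 8 := by rw [← Real.exp_nat_mul]; norm_num
          rw [Real.exp_neg, one_div]
          exact inv_anti₀ (by norm_num) h2
  have hw0 : 0 < w := by positivity
  have hnw : n * (n * w) ≤ 1 / 256 := by
    calc n * (n * w) ≤ n * (n * ((1 / 256) * (n ^ 10)⁻¹)) := by gcongr
      _ = (1 / 256) * (n ^ 8)⁻¹ := by field_simp
      _ ≤ (1 / 256) * 1 := by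
          gcongr
          exact inv_le_one_of_one_le₀ (one_le_pow₀ hn1)
      _ = _ := by norm_num
  have hnw1 : n * w ≤ 1 := by nlinarith [mul_pos hn0 hw0]
  have hbinom : (1 + w) ^ Fintype.card V - 1 ≤ 2 * (n * w) := by
    have h1 : (1 + w) ^ Fintype.card V ≤ Real.exp (n * w) := by
      rw [hn, Real.exp_nat_mul]
      gcongr
      linarith [Real.add_one_le_exp w]
    have h2 := Real.abs_exp_sub_one_le (x := n * w) (by rw [abs_of_pos (by positivity)]; exact hnw1)
    rw [abs_of_pos (by positivity : 0 < n * w)] at h2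
    linarith [le_abs_self (Real.exp (n * w) - 1)]
  have ht0 : t ≠ 0 := by
    rintro rfl
    have : 0 < 25 * n * T := by positivity
    push_cast at htpos
    linarith
  have hempty := hP.pow_two_mul_apply_self_le_of_eigenvalues (Real.exp_pos (-T⁻¹))
    (fun f hf => (hspec f hf).trans (mul_le_mul_of_nonneg_right
      (by linarith [Real.add_one_le_exp (-T⁻¹)]) (hff f))) ht0 x
  rw [← hn] at hempty
  have hdecay : n * Real.exp (-T⁻¹) ^ (2 * t) ≤ 1 / 32 := by
    have h1 : n ≤ Real.exp n := by linarith [Real.add_one_le_exp n]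
    have h2 : 50 * n ≤ 2 * t * T⁻¹ := by
      rw [← div_eq_mul_inv, le_div_iff₀ hT0]
      linarith
    calc n * Real.exp (-T⁻¹) ^ (2 * t) ≤ Real.exp n * Real.exp (-T⁻¹) ^ (2 * t) := by gcongr
      _ = Real.exp (n - 2 * t * T⁻¹) := by
          rw [← Real.exp_nat_mul, ← Real.exp_add]
          congr 1
          push_cast
          ring
      _ ≤ Real.exp (-31) := by
          rw [Real.exp_le_exp]
          linarith
      _ ≤ 1 / 32 := by
          rw [Real.exp_neg, one_div]
          exact inv_anti₀ (by norm_num) (by linarith [Real.add_one_le_exp (31 : ℝ)])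
  have hsplit : ∑ S, (killedMatrix P S ^ (2 * t)) x x =
      (P ^ (2 * t)) x x + ∑ S with S.Nonempty, (killedMatrix P S ^ (2 * t)) x x := by
    have h4 : (univ.filter Finset.Nonempty : Finset (Finset V)) = univ.erase ∅ := by
      ext S
      simp [Finset.nonempty_iff_ne_empty]
    rw [h4, ← Finset.add_sum_erase _ _ (Finset.mem_univ (∅ : Finset V)), killedMatrix_empty]
  rw [hsplit, mul_add]
  have h1 : n * (P ^ (2 * t)) x x ≤ n * (1 / n + Real.exp (-T⁻¹) ^ (2 * t)) := by gcongr
  have h2 : n * ∑ S with S.Nonempty, (killedMatrix P S ^ (2 * t)) x x ≤ n * (2 * (n * w)) := by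
    gcongr
    exact hsum.trans hbinom
  rw [mul_add, mul_one_div_cancel hn0.ne'] at h1
  linarith

end IsSymmStochastic

-- Connectedness with at least two vertices excludes degree `0`, for which the rows would vanish.
omit [DecidableEq V] in
theorem UGraph.isSymmStochastic_walkMatrix [Nontrivial V] {G : UGraph V} {d : ℕ}
    (hG : G.Connected) (hd : G.IsRegular d) : IsSymmStochastic G.walkMatrix := by
  have hd0 : d ≠ 0 := by
    obtain ⟨x, y, hxy⟩ := exists_pair_ne V
    rcases Relation.ReflTransGen.cases_head (hG x y) with h | ⟨z, hz, -⟩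
    · exact absurd h hxy
    · rintro rfl
      exact hz (Finset.sum_eq_zero_iff.1 (hd x) z (Finset.mem_univ z))
  refine ⟨fun x y => ?_, fun x y => ?_, fun x => ?_⟩
  · simp only [UGraph.walkMatrix, Matrix.of_apply]
    positivity
  · simp only [UGraph.walkMatrix, Matrix.of_apply, hd x, hd y, G.symm x y]
  · have hd1 : (d : ℝ) ≠ 0 := by exact_mod_cast hd0
    simp only [UGraph.walkMatrix, Matrix.of_apply, hd x, ← Finset.sum_div]
    rw [div_eq_one_iff_eq hd1, ← hd x]
    simp [UGraph.degree]

end SymmStochastic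

theorem theorem1 (κ : ℝ) (hκ : 0 < κ) :
    ∃ c : ℝ, 0 < c ∧
      ∀ (V : Type*) [Fintype V] [DecidableEq V] [Nontrivial V] (G : UGraph V) (d : ℕ),
        G.Connected → G.IsRegular d →
        maxHittingTime G.walkMatrix ≤ ENNReal.ofReal κ * (Fintype.card V : ℝ≥0∞) →
        (l2MixingTime G.lamplighterMatrix : ℝ≥0∞) ≤
          ENNReal.ofReal c * (Fintype.card V : ℝ≥0∞) *
            (relaxationTime G.walkMatrix + ENNReal.ofReal (Real.log (Fintype.card V))) := by
  -- The factor `2` absorbs the rounding of the time `B` up to an integer, as `B ≥ 1`.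
  refine ⟨2 * (35 * κ + 25), by positivity, fun V _ _ _ G d hG hd hH => ?_⟩
  have hP := UGraph.isSymmStochastic_walkMatrix hG hd
  have hn1 : (1 : ℝ) ≤ Fintype.card V := by exact_mod_cast Fintype.card_pos
  have hL : 0 ≤ Real.log (Fintype.card V) := Real.log_nonneg hn1
  have hc0 : ENNReal.ofReal (2 * (35 * κ + 25)) * (Fintype.card V : ℝ≥0∞) ≠ 0 := by
    refine mul_ne_zero ?_ (by simp)
    rw [Ne, ENNReal.ofReal_eq_zero, not_le]
    positivity
  by_cases htop : relaxationTime G.walkMatrix = ⊤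
  · rw [htop, top_add, ENNReal.mul_top hc0]
    exact le_top
  obtain ⟨T, hT0, hT⟩ : ∃ T : ℝ, 0 ≤ T ∧ relaxationTime G.walkMatrix = ENNReal.ofReal T :=
    ⟨_, ENNReal.toReal_nonneg, (ENNReal.ofReal_toReal htop).symm⟩
  have hH' : maxHittingTime G.walkMatrix ≤ ENNReal.ofReal (κ * Fintype.card V) := by
    rwa [ENNReal.ofReal_mul hκ.le, ENNReal.ofReal_natCast]
  have hT1 : 1 ≤ T := hP.one_le_relaxationTime
    (fun f hf => hP.eq_of_mulVec_eq_self (by positivity) hH' hf) hT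
  set B := (35 * κ + 25) * Fintype.card V * (T + Real.log (Fintype.card V)) with hB
  have hB1 : 1 ≤ B := by
    have h1 : 1 ≤ (35 * κ + 25) * Fintype.card V := by nlinarith
    have h2 : 1 ≤ T + Real.log (Fintype.card V) := by linarith
    nlinarith
  have hmix : l2MixingTime G.lamplighterMatrix ≤ (⌈B⌉₊ : ℕ∞) := by
    refine iInf₂_le_of_le ⌈B⌉₊ (fun t ht a => ?_) le_rfl
    rw [l2Dist_lamplighterMatrix hP, Real.sqrt_le_left (by norm_num)]
    have htB : B ≤ t := Nat.ceil_le.1 ht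
    have := hP.card_mul_sum_killedMatrix_le hκ hH' hT htB a.2
    norm_num at this ⊢
    exact this
  calc (l2MixingTime G.lamplighterMatrix : ℝ≥0∞) ≤ ((⌈B⌉₊ : ℕ∞) : ℝ≥0∞) := by
        exact_mod_cast hmix
    _ = ENNReal.ofReal (⌈B⌉₊ : ℝ) := by simp
    _ ≤ ENNReal.ofReal (2 * B) := by
        refine ENNReal.ofReal_le_ofReal ?_
        linarith [Nat.ceil_lt_add_one (a := B) (by linarith)]
    _ = _ := by
        rw [hT, ← ENNReal.ofReal_add hT0 hL, ← ENNReal.ofReal_natCast (Fintype.card V),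
          ← ENNReal.ofReal_mul (by positivity), ← ENNReal.ofReal_mul (by positivity), hB]
        congr 1
        ring
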